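/- All graphs are finite, simple and undirected, and a graph property $\Pi$ is a (possibly infinite, possibly undecidable) class of graphs closed under isomorphism. Say that $\Pi$ is *characterized by $c\in\mathbb N$ adjacencies* if for every $G\in\Pi$ and every $v\in V(G)$ there is a set $D\subseteq V(G)\setminus\{v\}$ with $|D|\le c$ such that every graph obtained from $G$ by adding or removing edges between $v$ and vertices of $V(G)\setminus D$ is also in $\Pi$. A graph $G$ is *vertex-minimal* with respect to $\Pi$ if $G\in\Pi$ and $G[S]\notin\Pi$ for all $S\subsetneq V(G)$. Write $\mathrm{vc}(G)$ for the minimum size of a vertex cover of $G$. For a fixed integer $q\ge 1$, consider the following parameterized problem, *Partition into $q$ disjoint $\Pi$-free subgraphs*. Input: a graph $G$ with a vertex cover $X\subseteq V(G)$. Parameter: $x:=|X|$. Question: can $V(G)$ be partitioned into $q$ (possibly empty) sets $S_1,\dots,S_q$ such that for each $i$ the graph $G[S_i]$ contains no graph of $\Pi$ as an induced subgraph? A *kernel* for a parameterized problem is a polynomial-time algorithm that maps every instance to an equivalent instance of the same problem whose encoding length and parameter are both at most $h(x)$ for some computable function $h$, where $x$ is the parameter of the input. It is a *kernel with $O(b(x))$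 vertices* if the number of vertices of the output graph is at most $g(x)$ for some function $g:\mathbb N\to\mathbb N$ with $g(x)=O(b(x))$ as $x\to\infty$. **Theorem.** Let $q\ge 1$ be an integer and let $\Pi$ be a graph property such that 1. $\Pi$ is characterized by $c_\Pi$ adjacencies, and 2. there is a non-decreasing polynomial $p:\mathbb N\to\mathbb N$ such that all graphs $G$ that are vertex-minimal with respect to $\Pi$ satisfy $|V(G)|\le p(\mathrm{vc}(G))$. Then the problem Partition into $q$ disjoint $\Pi$-free subgraphs, parameterized by the size $x=|X|$ of the given vertex cover, has a kernel with $O\bigl(p(x)\cdot x^{q\cdot c_\Pi}\bigr)$ vertices. -/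

import Mathlib

open Filter Asymptotics

/-- A graph property: a class of finite simple undirected graphs, closed under isomorphism
(graphs are considered up to the names of their vertices). -/
structure GraphProperty where
  /-- `Mem G`: the finite graph `G` belongs to the property -/
  Mem : ∀ {V : Type} [Finite V], SimpleGraph V → Prop
  /-- membership does not depend on the names of the vertices -/
  mem_of_iso : ∀ {V W : Type} [Finite V] [Finite W] (G : SimpleGraph V) (H : SimpleGraph W),
    Nonempty (G ≃g H) → Mem G → Mem H

namespace GraphProperty

/-- `Π` is characterized by `c` adjacencies: for every `G ∈ Π` and every vertex `v` there is a set
`D ⊆ V(G) ∖ {v}` of at most `c` vertices such that every graph `G'` obtained from `G` by adding or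
removing edges between `v` and vertices of `V(G) ∖ D` is also in `Π`. -/
def CharacterizedByAdjacencies (P : GraphProperty) (c : ℕ) : Prop :=
  ∀ (V : Type) [Finite V] (G : SimpleGraph V), P.Mem G → ∀ v : V,
    ∃ D : Finset V, v ∉ D ∧ D.card ≤ c ∧
      ∀ G' : SimpleGraph V,
        (∀ a b : V, a ≠ v → b ≠ v → (G'.Adj a b ↔ G.Adj a b)) →
        (∀ d ∈ D, (G'.Adj v d ↔ G.Adj v d)) →
        P.Mem G'

/-- `G` is vertex-minimal with respect to `Π`: it is in `Π`, and no subgraph induced by a proper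
subset of its vertices is. -/
def IsVertexMinimal (P : GraphProperty) {V : Type} [Finite V] (G : SimpleGraph V) : Prop :=
  P.Mem G ∧ ∀ S : Set V, S ⊂ Set.univ → ¬ P.Mem (G.induce S)

/-- `G` is `Π`-free: it does not contain a graph of `Π` as an induced subgraph. -/
def IsFree (P : GraphProperty) {V : Type} [Finite V] (G : SimpleGraph V) : Prop :=
  ∀ S : Set V, ¬ P.Mem (G.induce S)

/-- The vertex set of `G` can be partitioned into `q` (possibly empty) sets, each of which induces a
`Π`-free graph. -/
def HasFreePartition (P : GraphProperty) (q : ℕ) {V : Type} [Finite V] (G : SimpleGraph V) :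
    Prop :=
  ∃ S : Fin q → Set V, (Pairwise fun i j => Disjoint (S i) (S j)) ∧ (⋃ i, S i) = Set.univ ∧
    ∀ i, P.IsFree (G.induce (S i))

end GraphProperty

/-- `p : ℕ → ℕ` is a non-decreasing polynomial; the coefficients may be arbitrary real numbers, as
long as the values at natural numbers are natural numbers. -/
def IsNondecreasingPolynomial (p : ℕ → ℕ) : Prop :=
  Monotone p ∧ ∃ F : Polynomial ℝ, ∀ n : ℕ, (p n : ℝ) = F.eval (n : ℝ)

/-- An instance: a finite graph given together with a vertex cover, not necessarily a minimum
one. -/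
structure VCInstance where
  /-- the number of vertices -/
  n : ℕ
  /-- the graph -/
  G : SimpleGraph (Fin n)
  /-- the given vertex cover -/
  X : Finset (Fin n)
  /-- `X` is a vertex cover of `G` -/
  isVertexCover : G.IsVertexCover (X : Set (Fin n))

namespace VCInstance

/-- The parameter of an instance: the size of the given vertex cover. -/
def param (I : VCInstance) : ℕ := I.X.card

open Classical in
/-- The part of the encoding that describes the vertex `v`: a row mark `none`, one bit telling
whether `v` is in the vertex cover, and the row of `v` in the adjacency matrix. -/
noncomputable def encodeRow (I : VCInstance) (v : Fin I.n) : List (Option Bool) :=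
  none :: some (decide (v ∈ I.X)) :: List.ofFn fun w : Fin I.n => some (decide (I.G.Adj v w))

/-- The string over the alphabet `Option Bool` that encodes an instance: the rows of all vertices,
one after the other. Its length is `n * (n + 2)`. -/
noncomputable def encode (I : VCInstance) : List (Option Bool) :=
  (List.ofFn I.encodeRow).flatten

theorem length_encode (I : VCInstance) : I.encode.length = I.n * (I.n + 2) := by
  have h : (List.ofFn I.encodeRow).map List.length = List.replicate I.n (I.n + 2) := by
    rw [List.map_ofFn, ← List.ofFn_const]
    congr 1
    funext v
    simp [encodeRow]
  rw [encode, List.length_flatten, h]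
  simp

/-- Different instances have different encodings. -/
theorem encode_injective : Function.Injective encode := by
  intro I J h
  have hn : I.n = J.n := by
    have hl := congrArg List.length h
    rw [length_encode, length_encode] at hl
    nlinarith
  obtain ⟨n, G, X, hX⟩ := I
  obtain ⟨m, H, Y, hY⟩ := J
  obtain rfl : n = m := hn
  have hrow : ∀ v : Fin n, encodeRow ⟨n, G, X, hX⟩ v = encodeRow ⟨n, H, Y, hY⟩ v := by
    have h2 := (List.eq_iff_flatten_eq (L := List.ofFn (encodeRow ⟨n, G, X, hX⟩))
      (L' := List.ofFn (encodeRow ⟨n, H, Y, hY⟩))).2 ⟨h, by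
        rw [List.map_ofFn, List.map_ofFn]
        congr 1
        funext v
        simp [encodeRow]⟩
    exact fun v => congrFun (List.ofFn_injective h2) v
  have hXY : X = Y := by
    ext v
    have := hrow v
    simp [encodeRow] at this
    exact this.1
  have hGH : G = H := by
    ext v w
    have := hrow v
    simp [encodeRow] at this
    exact decide_eq_decide.1 (Option.some.inj (congrFun this.2 w))
  subst hXY
  subst hGH
  rfl

end VCInstance

/-- `f` is a kernelization algorithm for the problem `Q` (given as the set of its yes-instances)
parameterized by the size of the given vertex cover: a Turing machine computes `f` in polynomial
time, `f` maps every instance to an equivalent one, and the encoding length and the parameter of the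
output are bounded by a computable function of the parameter of the input. -/
structure IsKernelization (Q : Set VCInstance) (f : VCInstance → VCInstance) : Prop where
  polyTime : Nonempty (Turing.TM2ComputableInPolyTime VCInstance.encode VCInstance.encode f)
  equivalent : ∀ I : VCInstance, I ∈ Q ↔ f I ∈ Q
  size : ∃ h : ℕ → ℕ, Computable h ∧
    ∀ I : VCInstance, (f I).encode.length ≤ h I.param ∧ (f I).param ≤ h I.param

/-- `Q`, parameterized by the size `x` of the given vertex cover, has a kernel with `O(b x)`
vertices. -/
def HasKernelWithVertexBound (Q : Set VCInstance) (b : ℕ → ℝ) : Prop :=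
  ∃ f : VCInstance → VCInstance, IsKernelization Q f ∧
    ∃ g : ℕ → ℕ, (fun x => (g x : ℝ)) =O[atTop] b ∧ ∀ I : VCInstance, (f I).n ≤ g I.param

/-- The problem Partition into `q` disjoint `Π`-free subgraphs, as the set of its yes-instances. -/
def PartitionIntoFree (P : GraphProperty) (q : ℕ) : Set VCInstance :=
  {I | P.HasFreePartition q I.G}

/-! ### Induced members of Π, colourings, and their extension -/

namespace GraphProperty

variable {V W : Type}

/-! Put k = q·c. The kernel keeps the cover X and, for every k-tuple of vertices and every pattern
of adjacencies to it, the last M vertices outside X that show this pattern, where M ≥ q·p(x). All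
other vertices are deleted.

Correctness (`FreeOn.insert`, `FreeOn.extend`): a good colouring of G restricts to the kernel.
Conversely, add the deleted vertices one at a time. If v fits into no colour class, then for each
colour i there is a vertex-minimal T_i containing v whose other vertices have colour i. Each T_i has
at most p(x) vertices and a set D_i of at most c vertices that fixes the relevant adjacencies of v.
The union of the D_i has at most k elements, so at least q·p(x) kept vertices see it as v does
(`exists_similar_in_keptSet`), and one of them, u, lies in no T_i. For i the colour of u, replacing
v by u in T_i gives a member of Π inside colour class i, a contradiction.

Size (`card_keptSet_le`): vertices outside X are pairwise nonadjacent, so an entry of a tuple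
outside X carries no information and there are at most (2(x+1))^k patterns.

Since p may be constant or zero, keeping X is not always affordable. If c = 0, membership depends
only on the number of vertices, so minimal members have at most p(0) vertices; X is ignored and
q·p(0) vertices suffice. If p = 0, nothing is kept. If c ≥ 1, the factor x^k absorbs X.

Polynomial time is proved with an explicit machine: a small structured stack language is compiled to
`FinTM2` (`Run.reach`, `Prog.nonempty_computable`), and a program in it enumerates all n^k tuples
for each vertex and counts similar later vertices (`exec_program`). It uses M = m·(x+1)^d in place
of a multiple of p(x), with d the degree of p, so p is never evaluated. -/

theorem mem_comap_iff [Finite W] (P : GraphProperty) (G : SimpleGraph V) (f : W ↪ V) {T : Set V}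
    [Finite T] (hT : Set.range f = T) : P.Mem (G.comap f) ↔ P.Mem (G.induce T) := by
  subst hT
  have e : G.comap f ≃g G.induce (Set.range f) :=
    { toEquiv := Equiv.ofInjective f f.injective
      map_rel_iff' := by intro a b; simp [Equiv.ofInjective] }
  exact ⟨P.mem_of_iso _ _ ⟨e⟩, P.mem_of_iso _ _ ⟨e.symm⟩⟩

variable [Finite V] [Finite W]

theorem isFree_comap_iff (P : GraphProperty) (G : SimpleGraph V) (f : W ↪ V) :
    P.IsFree (G.comap f) ↔ ∀ T ⊆ Set.range f, ¬ P.Mem (G.induce T) := by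
  have key : ∀ S : Set W, P.Mem ((G.comap f).induce S) ↔ P.Mem (G.induce (f '' S)) := by
    intro S
    have hr : Set.range ((Function.Embedding.subtype (· ∈ S)).trans f) = f '' S := by
      ext x; simp
    exact P.mem_comap_iff G ((Function.Embedding.subtype (· ∈ S)).trans f) hr
  constructor
  · intro h T hT hm
    obtain ⟨S, rfl⟩ := Set.subset_range_iff_exists_image_eq.1 hT
    exact h S ((key _).2 hm)
  · intro h S hm
    exact h _ (Set.image_subset_range f S) ((key S).1 hm)

/-- The vertices in `K` can be coloured with `q` colours so that every colour class induces a
`Π`-free graph. -/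
def FreeOn (P : GraphProperty) (q : ℕ) (G : SimpleGraph V) (K : Set V) : Prop :=
  ∃ col : V → Fin q, ∀ i, ∀ T ⊆ K, (∀ t ∈ T, col t = i) → ¬ P.Mem (G.induce T)

/-- Moves partitions of a subgraph to colourings of a vertex set of the ambient graph, so that input
and kernel can be compared inside one graph. -/
theorem hasFreePartition_comap_iff (P : GraphProperty) {q : ℕ} (hq : 1 ≤ q) (G : SimpleGraph V)
    (f : W ↪ V) : P.HasFreePartition q (G.comap f) ↔ P.FreeOn q G (Set.range f) := by
  classical
  have key : ∀ S : Set W, P.IsFree ((G.comap f).induce S) ↔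
      ∀ T ⊆ f '' S, ¬ P.Mem (G.induce T) := by
    intro S
    have h := P.isFree_comap_iff G ((Function.Embedding.subtype (· ∈ S)).trans f)
    have hr : Set.range ((Function.Embedding.subtype (· ∈ S)).trans f) = f '' S := by
      ext x; simp
    rw [hr] at h
    exact h
  constructor
  · rintro ⟨S, hd, hu, hS⟩
    have hc : ∀ w : W, ∃ i, w ∈ S i := fun w => by
      have : w ∈ ⋃ i, S i := hu ▸ Set.mem_univ w
      simpa using this
    choose c hc using hc
    -- The colour off the range of `f` is irrelevant; some colour exists because q ≥ 1.
    refine ⟨Function.extend f c fun _ => ⟨0, hq⟩, fun i T hT hi hm => ?_⟩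
    refine (key (S i)).1 (hS i) T (fun t ht => ?_) hm
    obtain ⟨w, rfl⟩ := hT ht
    have := hi _ ht
    rw [f.injective.extend_apply] at this
    exact ⟨w, this ▸ hc w, rfl⟩
  · rintro ⟨col, hcol⟩
    refine ⟨fun i => {w | col (f w) = i}, ?_, ?_, fun i => ?_⟩
    · intro i j hij
      exact Set.disjoint_left.2 fun w hi hj => hij (hi.symm.trans hj)
    · ext w; simp
    · refine (key _).2 fun T hT => hcol i T (hT.trans (Set.image_subset_range _ _)) ?_
      intro t ht
      obtain ⟨w, hw, rfl⟩ := hT ht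
      exact hw

theorem hasFreePartition_iff (P : GraphProperty) {q : ℕ} (hq : 1 ≤ q) (G : SimpleGraph V) :
    P.HasFreePartition q G ↔ P.FreeOn q G Set.univ := by
  have h := P.hasFreePartition_comap_iff hq G (Function.Embedding.refl V)
  simp only [Function.Embedding.coe_refl, Set.range_id, SimpleGraph.comap_id] at h
  exact h

theorem FreeOn.mono {P : GraphProperty} {q : ℕ} {G : SimpleGraph V} {K L : Set V} (hKL : K ⊆ L)
    (h : P.FreeOn q G L) : P.FreeOn q G K := by
  obtain ⟨col, hcol⟩ := h
  exact ⟨col, fun i T hT => hcol i T (hT.trans hKL)⟩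

theorem exists_isVertexMinimal_induce (P : GraphProperty) (G : SimpleGraph V) (T : Set V)
    (h : P.Mem (G.induce T)) : ∃ T₀ ⊆ T, P.IsVertexMinimal (G.induce T₀) := by
  obtain ⟨T₀, hT, hmin⟩ := exists_minimal_le_of_wellFoundedLT
    (fun T : Set V => P.Mem (G.induce T)) T h
  refine ⟨T₀, hT, hmin.prop, fun S hS hm => ?_⟩
  have hr : Set.range ((Function.Embedding.subtype (· ∈ S)).trans
      (Function.Embedding.subtype (· ∈ T₀))) = Subtype.val '' S := by
    ext x; simp
  have h := (P.mem_comap_iff G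
    ((Function.Embedding.subtype (· ∈ S)).trans (Function.Embedding.subtype (· ∈ T₀))) hr).1 hm
  have hle := hmin.le_of_le h (by rintro _ ⟨a, -, rfl⟩; exact a.2)
  refine hS.2 fun a _ => ?_
  obtain ⟨b, hb, hba⟩ := hle a.2
  rwa [← Subtype.ext hba]

/-- One vertex can be added to a coloured set, if enough coloured vertices look like it. -/
theorem FreeOn.insert {P : GraphProperty} {q c m : ℕ} (hq : 1 ≤ q)
    (hP : P.CharacterizedByAdjacencies c) {G : SimpleGraph V}
    (hm : ∀ T : Set V, P.IsVertexMinimal (G.induce T) → Nat.card T ≤ m) {K : Set V} {v : V}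
    (hv : v ∉ K)
    (hK : ∀ Y : Finset V, Y.card ≤ q * c → ∃ U : Finset V, (U : Set V) ⊆ K ∧ q * m ≤ U.card ∧
      ∀ u ∈ U, ∀ y ∈ Y, (G.Adj u y ↔ G.Adj v y))
    (h : P.FreeOn q G K) : P.FreeOn q G (insert v K) := by
  classical
  obtain ⟨col, hcol⟩ := h
  by_contra hcon
  -- Giving v the colour i must create a member of Π. A minimal one inside it contains v, since
  -- otherwise `col` would already be bad on K; hence its colour is i.
  have hT : ∀ i, ∃ T : Set V, v ∈ T ∧ (∀ t ∈ T, t ≠ v → t ∈ K ∧ col t = i) ∧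
      P.IsVertexMinimal (G.induce T) := by
    intro i
    simp only [FreeOn, not_exists, not_forall] at hcon
    obtain ⟨j, T, hT, hj, hmem⟩ := hcon (Function.update col v i)
    rw [not_not] at hmem
    obtain ⟨T₀, hT₀, hmin⟩ := P.exists_isVertexMinimal_induce G T hmem
    have hcolT : ∀ t ∈ T₀, t ≠ v → t ∈ K ∧ col t = j := fun t ht htv =>
      ⟨(hT (hT₀ ht)).resolve_left htv, by simpa [htv] using hj t (hT₀ ht)⟩
    have hvT : v ∈ T₀ := by
      by_contra hvT
      have hne : ∀ t ∈ T₀, t ≠ v := fun t ht htv => hvT (htv ▸ ht)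
      exact hcol j T₀ (fun t ht => (hcolT t ht (hne t ht)).1)
        (fun t ht => (hcolT t ht (hne t ht)).2) hmin.1
    have hij : i = j := by simpa using hj v (hT₀ hvT)
    exact ⟨T₀, hvT, hij ▸ hcolT, hmin⟩
  choose T hvT hcolT hmin using hT
  choose D hvD hDc hD using fun i => hP _ _ (hmin i).1 ⟨v, hvT i⟩
  obtain ⟨U, hUK, hUm, hU⟩ := hK
    (Finset.univ.biUnion fun i => (D i).map (Function.Embedding.subtype _)) (by
      refine Finset.card_biUnion_le.trans ?_
      calc _ ≤ ∑ i : Fin q, c := Finset.sum_le_sum fun i _ => by simpa using hDc i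
        _ = q * c := by simp)
  -- Dropping v makes each bound strict, so the sets T_i without v together have fewer than q·m
  -- elements and cannot cover U.
  have hcard : (Finset.univ.biUnion fun i => (T i \ {v}).toFinite.toFinset).card < U.card := by
    refine (Finset.card_biUnion_le.trans_lt ?_).trans_le hUm
    calc _ < ∑ i : Fin q, m := by
          refine Finset.sum_lt_sum_of_nonempty ⟨⟨0, hq⟩, Finset.mem_univ _⟩ fun i _ => ?_
          refine lt_of_lt_of_le ?_ (hm (T i) (hmin i))
          rw [← Set.ncard_eq_toFinset_card, Nat.card_coe_set_eq]
          exact Set.ncard_sdiff_singleton_lt_of_mem (hvT i)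
      _ = q * m := by simp
  obtain ⟨u, huU, huT⟩ := Finset.exists_mem_notMem_of_card_lt_card hcard
  have huK : u ∈ K := hUK huU
  have huv : u ≠ v := fun h => hv (h ▸ huK)
  set i := col u with hi
  have huTi : u ∉ T i := by
    intro h
    exact huT (Finset.mem_biUnion.2 ⟨i, Finset.mem_univ _, by simpa using ⟨h, huv⟩⟩)
  -- Replace v by u; this is injective because u is not in T_i.
  let f : T i ↪ V := ⟨fun t => if (t : V) = v then u else t, by
    intro a b hab
    by_cases ha : (a : V) = v <;> by_cases hb : (b : V) = v <;>
      simp only [ha, hb, if_true, if_false] at hab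
    · exact Subtype.ext (ha.trans hb.symm)
    · exact absurd (hab ▸ b.2) huTi
    · exact absurd (hab ▸ a.2) huTi
    · exact Subtype.ext hab⟩
  have hf : ∀ t, f t = if (t : V) = v then u else (t : V) := fun _ => rfl
  -- Pulling G back along `f` changes only adjacencies at v, and none to D_i, because u and v agree
  -- on D_i.
  have hmem : P.Mem (G.comap f) := by
    refine hD i _ (fun a b ha hb => ?_) fun d hd => ?_
    · have ha' : (a : V) ≠ v := fun h => ha (Subtype.ext h)
      have hb' : (b : V) ≠ v := fun h => hb (Subtype.ext h)
      simp [hf, ha', hb']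
    · have hd' : (d : V) ≠ v := fun h => hvD i (by
        have : d = ⟨v, hvT i⟩ := Subtype.ext h
        rwa [← this])
      have := hU u huU d (Finset.mem_biUnion.2 ⟨i, Finset.mem_univ _,
        Finset.mem_map.2 ⟨d, hd, rfl⟩⟩)
      simpa [hf, hd'] using this
  rw [P.mem_comap_iff G f rfl] at hmem
  refine hcol i _ ?_ ?_ hmem
  · rintro _ ⟨t, rfl⟩
    rw [hf]
    split_ifs with h
    · exact huK
    · exact (hcolT i t t.2 h).1
  · rintro _ ⟨t, rfl⟩
    rw [hf]
    split_ifs with h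
    · rfl
    · exact (hcolT i t t.2 h).2

/-- The similar vertices are always found in the original K, so the condition survives while the
coloured set grows by repeated `FreeOn.insert`. -/
theorem FreeOn.extend {P : GraphProperty} {q c m : ℕ} (hq : 1 ≤ q)
    (hP : P.CharacterizedByAdjacencies c) {G : SimpleGraph V}
    (hm : ∀ T : Set V, P.IsVertexMinimal (G.induce T) → Nat.card T ≤ m) {K : Set V}
    (hK : ∀ v ∉ K, ∀ Y : Finset V, Y.card ≤ q * c → ∃ U : Finset V, (U : Set V) ⊆ K ∧
      q * m ≤ U.card ∧ ∀ u ∈ U, ∀ y ∈ Y, (G.Adj u y ↔ G.Adj v y))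
    (h : P.FreeOn q G K) : P.FreeOn q G Set.univ := by
  suffices ∀ S : Set V, S.Finite → P.FreeOn q G (S ∪ K) from
    (this Set.univ Set.finite_univ).mono Set.subset_union_left
  intro S hS
  induction S, hS using Set.Finite.induction_on with
  | empty => simpa using h
  | @insert a S _ _ ih =>
    by_cases ha : a ∈ S ∪ K
    · rwa [Set.insert_union, Set.insert_eq_of_mem ha]
    · rw [Set.insert_union]
      refine FreeOn.insert hq hP hm ha (fun Y hY => ?_) ih
      obtain ⟨U, hUK, h1, h2⟩ := hK a (fun h => ha (Or.inr h)) Y hY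
      exact ⟨U, hUK.trans Set.subset_union_right, h1, h2⟩

/-- Vertex-minimal induced subgraphs are small in terms of a vertex cover. -/
theorem card_le_of_isVertexCover {P : GraphProperty} {p : ℕ → ℕ} (hp : Monotone p)
    (hmin : ∀ (V : Type) [Finite V] (G : SimpleGraph V), P.IsVertexMinimal G →
      Nat.card V ≤ p G.vertexCoverNum.toNat)
    {G : SimpleGraph V} {X : Finset V} (hX : G.IsVertexCover (X : Set V)) (T : Set V)
    (hT : P.IsVertexMinimal (G.induce T)) : Nat.card T ≤ p X.card := by
  refine (hmin _ _ hT).trans (hp ?_)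
  have h1 : (G.induce T).IsVertexCover (Subtype.val ⁻¹' (X : Set V)) :=
    fun a b hab => hX (v := a.1) (w := b.1) hab
  refine ENat.toNat_le_of_le_natCast (h1.vertexCoverNum_le.trans ?_)
  calc (Subtype.val ⁻¹' (X : Set V) : Set T).encard
      = (Subtype.val '' (Subtype.val ⁻¹' (X : Set V) : Set T)).encard :=
        (Subtype.val_injective.encard_image _).symm
    _ ≤ (X : Set V).encard := Set.encard_le_encard (Set.image_preimage_subset _ _)
    _ = X.card := Set.encard_coe_eq_coe_finsetCard X

/-- A property characterized by no adjacencies depends on the number of vertices only. -/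
theorem CharacterizedByAdjacencies.mem_of_mem {P : GraphProperty}
    (hP : P.CharacterizedByAdjacencies 0) (G G' : SimpleGraph V) (h : P.Mem G) : P.Mem G' := by
  classical
  -- Rewire one vertex at a time: with D empty, all adjacencies of a vertex can be replaced by those
  -- in G' without leaving Π.
  suffices ∀ S : Set V, S.Finite → ∃ H : SimpleGraph V, P.Mem H ∧
      ∀ a ∈ S, ∀ b ∈ S, H.Adj a b ↔ G'.Adj a b by
    obtain ⟨H, hH, hadj⟩ := this Set.univ Set.finite_univ
    have : H = G' := by ext a b; exact hadj a trivial b trivial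
    rwa [← this]
  intro S hS
  induction S, hS using Set.Finite.induction_on with
  | empty => exact ⟨G, h, by simp⟩
  | @insert v S hv _ ih =>
    obtain ⟨H, hH, hadj⟩ := ih
    obtain ⟨D, -, hD, hmem⟩ := hP V H hH v
    have hD : D = ∅ := Finset.card_eq_zero.1 (Nat.le_zero.1 hD)
    let H' : SimpleGraph V :=
      { Adj := fun a b => if a = v ∨ b = v then G'.Adj a b else H.Adj a b
        symm := ⟨fun a b hab => by
          simpa only [or_comm (a := b = v), G'.adj_comm b a, H.adj_comm b a] using hab⟩
        loopless := ⟨fun a ha => by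
          split_ifs at ha
          · exact G'.loopless.irrefl _ ha
          · exact H.loopless.irrefl _ ha⟩ }
    have hH' : ∀ a b, H'.Adj a b ↔ if a = v ∨ b = v then G'.Adj a b else H.Adj a b :=
      fun _ _ => Iff.rfl
    refine ⟨H', hmem H' (fun a b ha hb => by simp [hH', ha, hb]) (by simp [hD]), ?_⟩
    intro a ha b hb
    rw [hH']
    split_ifs with hab
    · rfl
    · push Not at hab
      exact hadj a (ha.resolve_left hab.1) b (hb.resolve_left hab.2)

/-- The edgeless graph on the same vertices is vertex-minimal too, and its vertex cover number is 0.
-/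
theorem CharacterizedByAdjacencies.card_le {P : GraphProperty} {p : ℕ → ℕ}
    (hP : P.CharacterizedByAdjacencies 0)
    (hmin : ∀ (V : Type) [Finite V] (G : SimpleGraph V), P.IsVertexMinimal G →
      Nat.card V ≤ p G.vertexCoverNum.toNat)
    (G : SimpleGraph V) (hG : P.IsVertexMinimal G) : Nat.card V ≤ p 0 := by
  have h := hmin V ⊥ ⟨hP.mem_of_mem G ⊥ hG.1, fun S hS hm => hG.2 S hS (hP.mem_of_mem _ _ hm)⟩
  simpa [SimpleGraph.vertexCoverNum_eq_zero.2 rfl] using h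

end GraphProperty

/-! ### A structured language for programs on finitely many stacks -/

namespace StackLang

open Turing

variable {K A : Type} [DecidableEq K]

/-- The contents of the stacks. -/
abbrev Store (K A : Type) := K → List A

/-- The top symbols of the stacks. -/
def tops (s : Store K A) : K → Option A := fun k => (s k).head?

/-- Blocks: programs without loops, whose actions depend on the top symbols of the stacks. -/
inductive Block (K A : Type) : Type
  | skip : Block K A
  | push (k : K) (f : (K → Option A) → A) : Block K A
  | pop (k : K) : Block K A
  | seq (b₁ b₂ : Block K A) : Block K A
  | ite (p : (K → Option A) → Bool) (b₁ b₂ : Block K A) : Block K A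

/-- The effect of a block. -/
def Block.exec : Block K A → Store K A → Store K A
  | skip, s => s
  | push k f, s => Function.update s k (f (tops s) :: s k)
  | pop k, s => Function.update s k (s k).tail
  | seq b₁ b₂, s => b₂.exec (b₁.exec s)
  | ite p b₁ b₂, s => cond (p (tops s)) (b₁.exec s) (b₂.exec s)

/-- Programs. -/
inductive Prog (K A : Type) : Type
  | block (b : Block K A) : Prog K A
  | seq (c₁ c₂ : Prog K A) : Prog K A
  | ite (p : (K → Option A) → Bool) (c₁ c₂ : Prog K A) : Prog K A
  | loop (p : (K → Option A) → Bool) (c : Prog K A) : Prog K A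

/-- `Run c s s' t`: the program `c`, started in `s`, ends in `s'` after at most `t` steps. -/
inductive Run : Prog K A → Store K A → Store K A → ℕ → Prop
  | block (b : Block K A) (s : Store K A) : Run (.block b) s (b.exec s) 1
  | seq {c₁ c₂ : Prog K A} {s₁ s₂ s₃ : Store K A} {t₁ t₂ : ℕ} :
      Run c₁ s₁ s₂ t₁ → Run c₂ s₂ s₃ t₂ → Run (.seq c₁ c₂) s₁ s₃ (t₁ + t₂)
  | ite_true {p : (K → Option A) → Bool} {c₁ c₂ : Prog K A} {s s' : Store K A} {t : ℕ} :
      p (tops s) = true → Run c₁ s s' t → Run (.ite p c₁ c₂) s s' (1 + t)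
  | ite_false {p : (K → Option A) → Bool} {c₁ c₂ : Prog K A} {s s' : Store K A} {t : ℕ} :
      p (tops s) = false → Run c₂ s s' t → Run (.ite p c₁ c₂) s s' (1 + t)
  | loop_false {p : (K → Option A) → Bool} {c : Prog K A} {s : Store K A} :
      p (tops s) = false → Run (.loop p c) s s 1
  | loop_true {p : (K → Option A) → Bool} {c : Prog K A} {s₁ s₂ s₃ : Store K A} {t₁ t₂ : ℕ} :
      p (tops s₁) = true → Run c s₁ s₂ t₁ → Run (.loop p c) s₂ s₃ t₂ →
        Run (.loop p c) s₁ s₃ (1 + t₁ + t₂)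
  | mono {c : Prog K A} {s s' : Store K A} {t t' : ℕ} : Run c s s' t → t ≤ t' → Run c s s' t'

/-- The labels of the Turing machine that executes a program. -/
def Prog.Label : Prog K A → Type
  | block _ => Unit
  | seq c₁ c₂ => c₁.Label ⊕ c₂.Label
  | ite _ c₁ c₂ => Unit ⊕ (c₁.Label ⊕ c₂.Label)
  | loop _ c => Unit ⊕ c.Label

instance Prog.finiteLabel : (c : Prog K A) → Finite c.Label
  | block _ => inferInstanceAs (Finite Unit)
  | seq c₁ c₂ =>
    have := c₁.finiteLabel
    have := c₂.finiteLabel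
    inferInstanceAs (Finite (c₁.Label ⊕ c₂.Label))
  | ite _ c₁ c₂ =>
    have := c₁.finiteLabel
    have := c₂.finiteLabel
    inferInstanceAs (Finite (Unit ⊕ (c₁.Label ⊕ c₂.Label)))
  | loop _ c =>
    have := c.finiteLabel
    inferInstanceAs (Finite (Unit ⊕ c.Label))

/-- The label where the execution of a program starts. -/
def Prog.entry : (c : Prog K A) → c.Label
  | block _ => ()
  | seq c₁ _ => Sum.inl c₁.entry
  | ite _ _ _ => Sum.inl ()
  | loop _ _ => Sum.inl ()

/-! ### Compilation of programs to Turing machines -/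

section Compile

variable {L : Type}

/-- The statements of the Turing machine; the internal state holds the top symbols. -/
abbrev MStmt (K A L : Type) := TM2.Stmt (fun _ : K => A) L (K → Option A)

/-- Read the top symbols of the stacks in the list. -/
def peekList : List K → MStmt K A L → MStmt K A L
  | [], q => q
  | k :: l, q => .peek k (fun v o => Function.update v k o) (peekList l q)

theorem stepAux_peekList (l : List K) (q : MStmt K A L) (v : K → Option A) (s : Store K A) :
    TM2.stepAux (peekList l q) v s =
      TM2.stepAux q (fun k => if k ∈ l then (s k).head? else v k) s := by
  induction l generalizing v with
  | nil => simp [peekList]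
  | cons a l ih =>
    rw [peekList, TM2.stepAux, ih]
    congr 1
    funext k
    by_cases hk : k = a
    · subst hk; simp
    · by_cases hl : k ∈ l <;> simp [hk, hl]

/-- The machine `M` gets from label `l` and stacks `s` to label `l'` and stacks `s'` in at most `t`
steps. -/
def Reach (M : L → MStmt K A L) (l l' : L) (s s' : Store K A) (t : ℕ) : Prop :=
  ∀ v : K → Option A, ∃ v' : K → Option A, ∃ n ≤ t,
    (flip Bind.bind (TM2.step M))^[n] (some ⟨some l, v, s⟩) = some ⟨some l', v', s'⟩

theorem Reach.trans {M : L → MStmt K A L} {l₁ l₂ l₃ : L} {s₁ s₂ s₃ : Store K A} {t₁ t₂ : ℕ}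
    (h₁ : Reach M l₁ l₂ s₁ s₂ t₁) (h₂ : Reach M l₂ l₃ s₂ s₃ t₂) :
    Reach M l₁ l₃ s₁ s₃ (t₁ + t₂) := by
  intro v
  obtain ⟨v₁, n₁, hn₁, e₁⟩ := h₁ v
  obtain ⟨v₂, n₂, hn₂, e₂⟩ := h₂ v₁
  exact ⟨v₂, n₂ + n₁, by omega, by rw [Function.iterate_add_apply, e₁, e₂]⟩

theorem Reach.mono {M : L → MStmt K A L} {l₁ l₂ : L} {s₁ s₂ : Store K A} {t₁ t₂ : ℕ}
    (h : Reach M l₁ l₂ s₁ s₂ t₁) (ht : t₁ ≤ t₂) : Reach M l₁ l₂ s₁ s₂ t₂ := by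
  intro v
  obtain ⟨v', n, hn, e⟩ := h v
  exact ⟨v', n, hn.trans ht, e⟩

theorem Reach.of_stepAux {M : L → MStmt K A L} {l₁ l₂ : L} {s₁ s₂ : Store K A}
    (h : ∀ v, ∃ v', TM2.stepAux (M l₁) v s₁ = ⟨some l₂, v', s₂⟩) : Reach M l₁ l₂ s₁ s₂ 1 := by
  intro v
  obtain ⟨v', e⟩ := h v
  refine ⟨v', 1, le_rfl, ?_⟩
  change some (TM2.stepAux (M l₁) v s₁) = _
  rw [e]

variable [Fintype K]

/-- Read the top symbols of all stacks. -/
noncomputable def peekAll (q : MStmt K A L) : MStmt K A L := peekList Finset.univ.toList q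

@[simp] theorem stepAux_peekAll (q : MStmt K A L) (v : K → Option A) (s : Store K A) :
    TM2.stepAux (peekAll q) v s = TM2.stepAux q (tops s) s := by
  simp [peekAll, stepAux_peekList]
  rfl

/-- The code of a block, followed by `q`. -/
noncomputable def Block.code : Block K A → MStmt K A L → MStmt K A L
  | skip, q => q
  | push k f, q => peekAll (.push k f q)
  | pop k, q => .pop k (fun v _ => v) q
  | seq b₁ b₂, q => b₁.code (b₂.code q)
  | ite p b₁ b₂, q => peekAll (.branch p (b₁.code q) (b₂.code q))

/-- A block contains no jump, so it runs within one machine step. The internal state left behind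
need not be known: every push and every test first rereads the top symbols. -/
theorem Block.exists_stepAux_code (b : Block K A) (q : MStmt K A L) (v : K → Option A)
    (s : Store K A) : ∃ v', TM2.stepAux (b.code q) v s = TM2.stepAux q v' (b.exec s) := by
  induction b generalizing q v s with
  | skip => exact ⟨v, rfl⟩
  | push k f => exact ⟨tops s, by simp [Block.code, Block.exec]⟩
  | pop k => exact ⟨v, by simp [Block.code, Block.exec]⟩
  | seq b₁ b₂ ih₁ ih₂ =>
    obtain ⟨v₁, h₁⟩ := ih₁ (b₂.code q) v s
    obtain ⟨v₂, h₂⟩ := ih₂ q v₁ (b₁.exec s)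
    exact ⟨v₂, h₁.trans h₂⟩
  | ite p b₁ b₂ ih₁ ih₂ =>
    rw [Block.code, stepAux_peekAll, TM2.stepAux, Block.exec]
    cases p (tops s)
    · exact ih₂ q _ s
    · exact ih₁ q _ s

/-- The code of a program whose labels are embedded by `emb` and which continues at `exit`. -/
noncomputable def Prog.code : (c : Prog K A) → (c.Label → L) → L → c.Label → MStmt K A L
  | block b, _, exit, _ => b.code (.goto fun _ => exit)
  | seq c₁ c₂, emb, exit, l => match l with
    | .inl l => c₁.code (fun l => emb (.inl l)) (emb (.inr c₂.entry)) l
    | .inr l => c₂.code (fun l => emb (.inr l)) exit l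
  | ite p c₁ c₂, emb, exit, l => match l with
    | .inl _ => peekAll (.branch p (.goto fun _ => emb (.inr (.inl c₁.entry)))
        (.goto fun _ => emb (.inr (.inr c₂.entry))))
    | .inr (.inl l) => c₁.code (fun l => emb (.inr (.inl l))) exit l
    | .inr (.inr l) => c₂.code (fun l => emb (.inr (.inr l))) exit l
  | loop p c, emb, exit, l => match l with
    | .inl _ => peekAll (.branch p (.goto fun _ => emb (.inr c.entry)) (.goto fun _ => exit))
    | .inr l => c.code (fun l => emb (.inr l)) (emb (.inl ())) l

/-- Induction on the run, with the embedding of labels and the exit label general enough for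
subprograms. A loop body is compiled with the loop's own test as its exit. -/
theorem Run.reach {c : Prog K A} {s s' : Store K A} {t : ℕ} (h : Run c s s' t)
    (M : L → MStmt K A L) (emb : c.Label → L) (exit : L)
    (hM : ∀ l, M (emb l) = c.code emb exit l) : Reach M (emb c.entry) exit s s' t := by
  induction h generalizing exit with
  | block b s =>
    refine Reach.of_stepAux fun v => ?_
    obtain ⟨v', e⟩ := b.exists_stepAux_code (.goto fun _ => exit) v s
    exact ⟨v', by rw [hM]; exact e⟩
  | @seq c₁ c₂ _ _ _ _ _ _ _ ih₁ ih₂ =>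
    exact (ih₁ (fun l => emb (.inl l)) (emb (.inr c₂.entry)) fun l => hM (.inl l)).trans
      (ih₂ (fun l => emb (.inr l)) exit fun l => hM (.inr l))
  | @ite_true p c₁ c₂ s _ _ hp _ ih =>
    refine Reach.trans (Reach.of_stepAux fun v => ⟨tops s, ?_⟩)
      (ih (fun l => emb (.inr (.inl l))) exit fun l => hM (.inr (.inl l)))
    rw [hM]
    simp [Prog.code, Prog.entry, hp]
  | @ite_false p c₁ c₂ s _ _ hp _ ih =>
    refine Reach.trans (Reach.of_stepAux fun v => ⟨tops s, ?_⟩)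
      (ih (fun l => emb (.inr (.inr l))) exit fun l => hM (.inr (.inr l)))
    rw [hM]
    simp [Prog.code, Prog.entry, hp]
  | @loop_false p c s hp =>
    refine Reach.of_stepAux fun v => ⟨tops s, ?_⟩
    rw [hM]
    simp [Prog.code, Prog.entry, hp]
  | @loop_true p c s _ _ _ _ hp _ _ ih₁ ih₂ =>
    refine (Reach.trans (Reach.of_stepAux fun v => ⟨tops s, ?_⟩)
      (ih₁ (fun l => emb (.inr l)) (emb (.inl ())) fun l => hM (.inr l))).trans (ih₂ emb exit hM)
    rw [hM]
    simp [Prog.code, Prog.entry, hp]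
  | mono _ ht ih => exact (ih emb exit hM).mono ht

/-- The Turing machine that executes a program. -/
noncomputable def Prog.machine [Fintype A] (c : Prog K A) (k₀ k₁ : K) : FinTM2 where
  K := K
  k₀ := k₀
  k₁ := k₁
  Γ := fun _ => A
  Λ := Option c.Label
  main := some c.entry
  ΛFin := @Fintype.ofFinite _ (@instFiniteOption _ c.finiteLabel)
  σ := K → Option A
  initialState := fun _ => none
  m := fun l => match l with
    -- A halting configuration must carry the initial internal state, so the top symbols are erased;
    -- this costs the one extra step in the time bound.
    | none => .load (fun _ _ => none) .halt
    | some l => c.code some none l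

theorem Prog.initList_machine [Fintype A] (c : Prog K A) (k₀ k₁ : K) (w : List A) :
    initList (c.machine k₀ k₁) w =
      ⟨some (some c.entry), fun _ => none, Function.update (fun _ => []) k₀ w⟩ := by
  unfold initList
  congr 1
  funext (k : K)
  obtain rfl | hk := eq_or_ne k k₀
  · exact (dif_pos rfl).trans (Function.update_self (β := fun _ => List A) k w fun _ => []).symm
  · exact (dif_neg hk).trans (Function.update_of_ne (β := fun _ => List A) hk w fun _ => []).symm

theorem Prog.haltList_machine [Fintype A] (c : Prog K A) (k₀ k₁ : K) (w : List A) :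
    haltList (c.machine k₀ k₁) w =
      ⟨none, fun _ => none, Function.update (fun _ => []) k₁ w⟩ := by
  unfold haltList
  congr 1
  funext (k : K)
  obtain rfl | hk := eq_or_ne k k₁
  · exact (dif_pos rfl).trans (Function.update_self (β := fun _ => List A) k w fun _ => []).symm
  · exact (dif_neg hk).trans (Function.update_of_ne (β := fun _ => List A) hk w fun _ => []).symm

/-- A program that computes `f` in polynomial time gives a Turing machine that does. -/
theorem Prog.nonempty_computable [Fintype A] {α β : Type} (ea : α → List A) (eb : β → List A)
    (f : α → β) (c : Prog K A) (k₀ k₁ : K) (time : Polynomial ℕ)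
    (h : ∀ a, Run c (Function.update (fun _ => []) k₀ (ea a))
      (Function.update (fun _ => []) k₁ (eb (f a))) (time.eval (ea a).length)) :
    Nonempty (TM2ComputableInPolyTime ea eb f) := by
  refine ⟨⟨⟨c.machine k₀ k₁, Equiv.refl _, Equiv.refl _⟩, time + 1, fun a => ?_⟩⟩
  have hr := (h a).reach (c.machine k₀ k₁).m some none (fun _ => rfl) (fun _ => none)
  refine Classical.choice ?_
  obtain ⟨v', n, hn, e⟩ := hr
  refine ⟨⟨⟨n + 1, ?_⟩, ?_⟩⟩
  · rw [Function.iterate_succ_apply']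
    have e₁ := (congrArg (initList (c.machine k₀ k₁)) (List.map_id (ea a))).trans
      (c.initList_machine k₀ k₁ (ea a))
    have e₂ := (congrArg (haltList (c.machine k₀ k₁)) (List.map_id (eb (f a)))).trans
      (c.haltList_machine k₀ k₁ (eb (f a)))
    refine (congrArg (flip Bind.bind _) ((congrArg _ (congrArg some e₁)).trans e)).trans ?_
    exact (congrArg some e₂).symm
  · simpa using hn

end Compile

end StackLang

/-! ### The program that computes the kernel -/

namespace KernelProgram

open StackLang

/-- The alphabet: marks and bits. -/
abbrev Sym := Option Bool

/-- The stacks of the program. -/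
inductive Stk : Type
  | inp | rev | xs | ys | keep | todo | done | cur | old | flag | pos | opos | lim | olim | found
  | out
  deriving DecidableEq

instance : Fintype Stk :=
  ⟨{.inp, .rev, .xs, .ys, .keep, .todo, .done, .cur, .old, .flag, .pos, .opos, .lim, .olim, .found,
    .out}, fun k => by cases k <;> decide⟩

/-- The contents of the stacks, as a record. -/
structure State where
  inp : List Sym := []
  rev : List Sym := []
  xs : List Sym := []
  ys : List Sym := []
  keep : List Sym := []
  todo : List Sym := []
  done : List Sym := []
  cur : List Sym := []
  old : List Sym := []
  flag : List Sym := []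
  pos : List Sym := []
  opos : List Sym := []
  lim : List Sym := []
  olim : List Sym := []
  found : List Sym := []
  out : List Sym := []

/-- The contents of the stacks, as a function. -/
def State.store (s : State) : Store Stk Sym
  | .inp => s.inp
  | .rev => s.rev
  | .xs => s.xs
  | .ys => s.ys
  | .keep => s.keep
  | .todo => s.todo
  | .done => s.done
  | .cur => s.cur
  | .old => s.old
  | .flag => s.flag
  | .pos => s.pos
  | .opos => s.opos
  | .lim => s.lim
  | .olim => s.olim
  | .found => s.found
  | .out => s.out

abbrev Prg := Prog Stk Sym

/-- `Exec c s s' t`: the program `c` leads from `s` to `s'` in at most `t` steps. -/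
def Exec (c : Prg) (s s' : State) (t : ℕ) : Prop := Run c s.store s'.store t

/-- Stated stack by stack, so that a case split on the stack lets both sides reduce. -/
theorem Exec.block {b : Block Stk Sym} {s s' : State} (h : ∀ k, b.exec s.store k = s'.store k) :
    Exec (.block b) s s' 1 := by
  have h := Run.block b s.store
  rwa [funext ‹∀ k, b.exec s.store k = s'.store k›] at h

theorem Exec.seq {c₁ c₂ : Prg} {s₁ s₂ s₃ : State} {t₁ t₂ : ℕ} (h₁ : Exec c₁ s₁ s₂ t₁)
    (h₂ : Exec c₂ s₂ s₃ t₂) : Exec (.seq c₁ c₂) s₁ s₃ (t₁ + t₂) := Run.seq h₁ h₂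

theorem Exec.mono {c : Prg} {s s' : State} {t t' : ℕ} (h : Exec c s s' t) (ht : t ≤ t') :
    Exec c s s' t' := Run.mono h ht

theorem Exec.of_eq {c : Prg} {s s' s'' : State} {t t' : ℕ} (h : Exec c s s' t) (hs : s' = s'')
    (ht : t ≤ t') : Exec c s s'' t' := hs ▸ h.mono ht

theorem Exec.loop_true {p : (Stk → Option Sym) → Bool} {c : Prg} {s₁ s₂ s₃ : State} {t₁ t₂ : ℕ}
    (hp : p (tops s₁.store) = true) (h₁ : Exec c s₁ s₂ t₁) (h₂ : Exec (.loop p c) s₂ s₃ t₂) :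
    Exec (.loop p c) s₁ s₃ (1 + t₁ + t₂) := Run.loop_true hp h₁ h₂

theorem Exec.loop_false {p : (Stk → Option Sym) → Bool} {c : Prg} {s : State}
    (hp : p (tops s.store) = false) : Exec (.loop p c) s s 1 := Run.loop_false hp

theorem Exec.ite_true {p : (Stk → Option Sym) → Bool} {c₁ c₂ : Prg} {s s' : State} {t : ℕ}
    (hp : p (tops s.store) = true) (h : Exec c₁ s s' t) : Exec (.ite p c₁ c₂) s s' (1 + t) :=
  Run.ite_true hp h

theorem Exec.ite_false {p : (Stk → Option Sym) → Bool} {c₁ c₂ : Prg} {s s' : State} {t : ℕ}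
    (hp : p (tops s.store) = false) (h : Exec c₂ s s' t) : Exec (.ite p c₁ c₂) s s' (1 + t) :=
  Run.ite_false hp h

/-! #### Basic programs -/

/-- Move the top symbol of `k` to `l`. -/
def mv (k l : Stk) : Block Stk Sym :=
  .ite (fun T => (T k).isSome) (.seq (.push l fun T => (T k).getD none) (.pop k)) .skip

/-- Move all symbols of `k` to `l`. -/
def pour (k l : Stk) : Prg := .loop (fun T => (T k).isSome) (.block (mv k l))

/-- Delete all symbols of `k`. -/
def clear (k : Stk) : Prg := .loop (fun T => (T k).isSome) (.block (.pop k))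

theorem run_pour {k l : Stk} (hkl : k ≠ l) (w : List Sym) (s : Store Stk Sym) (hw : s k = w) :
    Run (pour k l) s (Function.update (Function.update s l (w.reverse ++ s l)) k [])
      (2 * w.length + 1) := by
  induction w generalizing s with
  | nil =>
    have : Function.update (Function.update s l (([] : List Sym).reverse ++ s l)) k [] = s := by
      rw [List.reverse_nil, List.nil_append, Function.update_eq_self, ← hw,
        Function.update_eq_self]
    rw [this]
    exact .loop_false (by simp [tops, hw])
  | cons a w ih =>
    have hb : (mv k l).exec s = Function.update (Function.update s l (a :: s l)) k w := by
      simp [mv, Block.exec, tops, hw, Function.update_of_ne hkl]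
    have h := ih (Function.update (Function.update s l (a :: s l)) k w) (by simp)
    have he : Function.update (Function.update
        (Function.update (Function.update s l (a :: s l)) k w) l (w.reverse ++
          (Function.update (Function.update s l (a :: s l)) k w) l)) k [] =
        Function.update (Function.update s l ((a :: w).reverse ++ s l)) k [] := by
      funext m
      by_cases hm : m = k
      · subst hm; simp
      · by_cases hm' : m = l
        · subst hm'; simp [hm]
        · simp [hm, hm']
    rw [he] at h
    exact (Run.loop_true (by simp [tops, hw]) (hb ▸ Run.block (mv k l) s) h).mono (by simp; omega)

theorem run_clear (k : Stk) (w : List Sym) (s : Store Stk Sym) (hw : s k = w) :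
    Run (clear k) s (Function.update s k []) (2 * w.length + 1) := by
  induction w generalizing s with
  | nil =>
    have : Function.update s k [] = s := by rw [← hw, Function.update_eq_self]
    rw [this]
    exact .loop_false (by simp [tops, hw])
  | cons a w ih =>
    have hb : (Block.pop k).exec s = Function.update s k w := by
      simp [Block.exec, hw]
    have h := ih (Function.update s k w) (Function.update_self k w s)
    rw [Function.update_idem] at h
    exact (Run.loop_true (by simp [tops, hw]) (hb ▸ Run.block (.pop k) s) h).mono (by simp; omega)

theorem exec_clear {k : Stk} (s s' : State) (h : Function.update s.store k [] = s'.store) :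
    Exec (clear k) s s' (2 * (s.store k).length + 1) := by
  have := run_clear k _ s.store rfl
  rwa [h] at this

theorem exec_pour {k l : Stk} (hkl : k ≠ l) (s s' : State)
    (h : Function.update (Function.update s.store l ((s.store k).reverse ++ s.store l)) k [] =
      s'.store) : Exec (pour k l) s s' (2 * (s.store k).length + 1) := by
  have := run_pour hkl _ s.store rfl
  rwa [h] at this

end KernelProgram

/-! ### Reading the input and computing the limit in unary -/

namespace KernelProgram

open StackLang

variable {V : Type}

/-- The bits of a list of vertices. -/
def bits (l : List V) (g : V → Bool) : List Sym := l.map fun v => some (g v)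

@[simp] theorem length_bits (l : List V) (g : V → Bool) : (bits l g).length = l.length :=
  List.length_map _

theorem bits_reverse (l : List V) (g : V → Bool) : bits l.reverse g = (bits l g).reverse :=
  List.map_reverse

@[simp] theorem bits_append (l m : List V) (g : V → Bool) :
    bits (l ++ m) g = bits l g ++ bits m g := List.map_append

@[simp] theorem bits_nil (g : V → Bool) : bits [] g = [] := rfl

@[simp] theorem bits_cons (v : V) (l : List V) (g : V → Bool) :
    bits (v :: l) g = some (g v) :: bits l g := rfl

/-- The part of the input that describes the vertex `v`. -/
def row (vs : List V) (x : V → Bool) (a : V → V → Bool) (v : V) : List Sym :=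
  none :: some (x v) :: bits vs (a v)

@[simp] theorem length_row (vs : List V) (x : V → Bool) (a : V → V → Bool) (v : V) :
    (row vs x a v).length = vs.length + 2 := by simp [row]

theorem length_flatMap_row (vs l : List V) (x : V → Bool) (a : V → V → Bool) :
    (l.flatMap (row vs x a)).length = l.length * (vs.length + 2) := by
  simp [List.length_flatMap]

/-! #### Reading the vertex cover -/

/-- Move the input to `rev`, and the bits of the vertex cover to `ys`; if `b = false`, all of these
bits are replaced by zeros. -/
def scan (b : Bool) : Prg :=
  .loop (fun T => (T .inp).isSome) <| .block <|
    .ite (fun T => T .inp == some none)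
      (.seq (mv .inp .rev) (.push .ys fun T => ((T .inp).getD none).map (· && b)))
      (mv .inp .rev)

theorem exec_scan_bits (b : Bool) (l : List V) (g : V → Bool) (r : List Sym) (s s' : State) (t : ℕ)
    (h : Exec (scan b) { s with inp := r, rev := (bits l g).reverse ++ s.rev } s' t) :
    Exec (scan b) { s with inp := bits l g ++ r } s' (2 * l.length + t) := by
  induction l generalizing s with
  | nil => exact h.mono (by simp)
  | cons v l ih =>
    refine (Exec.loop_true rfl (.block (s' := { s with
      inp := bits l g ++ r, rev := some (g v) :: s.rev }) fun k => ?_)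
      (ih { s with rev := some (g v) :: s.rev } ?_)).mono ?_
    · cases k <;> rfl
    · simpa using h
    · simp; omega

/-- Only the copy on `ys` is blanked when `b = false`. The original rows survive on `rev`, so the
true cover bits can still be written to the output. -/
theorem exec_scan (b : Bool) (vs l : List V) (x : V → Bool) (a : V → V → Bool) (s : State) :
    Exec (scan b) { s with inp := l.flatMap (row vs x a) }
      { s with
        inp := []
        rev := (l.flatMap (row vs x a)).reverse ++ s.rev
        ys := (bits l fun v => x v && b).reverse ++ s.ys }
      (2 * (l.length * (vs.length + 2)) + 1) := by
  induction l generalizing s with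
  | nil => exact (Exec.loop_false rfl).mono (by simp)
  | cons v l ih =>
    rw [List.flatMap_cons]
    refine (Exec.loop_true rfl (.block (s' := { s with
      inp := some (x v) :: (bits vs (a v) ++ l.flatMap (row vs x a)), rev := none :: s.rev
      ys := some (x v && b) :: s.ys }) fun k => ?_)
      (Exec.loop_true rfl (.block (s' := { s with
        inp := bits vs (a v) ++ l.flatMap (row vs x a)
        rev := some (x v) :: none :: s.rev
        ys := some (x v && b) :: s.ys }) fun k => ?_)
      (exec_scan_bits b vs (a v) (l.flatMap (row vs x a)) { s with
        rev := some (x v) :: none :: s.rev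
        ys := some (x v && b) :: s.ys } _ _ ((ih { s with
          rev := (bits vs (a v)).reverse ++ some (x v) :: none :: s.rev
          ys := some (x v && b) :: s.ys }).of_eq ?_ le_rfl)))).mono ?_
    · cases k <;> rfl
    · cases k <;> rfl
    · simp [row]
    · simp; ring_nf; omega

/-! #### Computing the limit -/

/-- Push `m` marks. -/
def pushMarks (k : Stk) : ℕ → Block Stk Sym
  | 0 => .skip
  | m + 1 => .seq (pushMarks k m) (.push k fun _ => none)

theorem exec_pushMarks (m : ℕ) (s : State) :
    (pushMarks .lim m).exec s.store = { s with lim := List.replicate m none ++ s.lim }.store := by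
  induction m with
  | zero => rfl
  | succ m ih =>
    rw [pushMarks, Block.exec, ih]
    funext k; cases k <;> rfl

/-- For every set bit in `xs`, push a mark on `olim`; the bits are moved to `ys`. -/
def countLoop : Prg :=
  .loop (fun T => (T .xs).isSome)
    (.block (.seq (.ite (fun T => T .xs == some (some true)) (.push .olim fun _ => none) .skip)
      (mv .xs .ys)))

theorem exec_countLoop (l : List V) (g : V → Bool) (s : State) :
    Exec countLoop { s with xs := bits l g }
      { s with
        xs := []
        ys := (bits l g).reverse ++ s.ys
        olim := List.replicate (l.countP g) none ++ s.olim } (2 * l.length + 1) := by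
  induction l generalizing s with
  | nil => exact Exec.loop_false rfl
  | cons v l ih =>
    cases hv : g v
    · refine (Exec.loop_true rfl (.block (s' := { s with
        xs := bits l g
        ys := some (g v) :: s.ys }) fun k => ?_) (ih { s with
          ys := some (g v) :: s.ys })).of_eq ?_ ?_
      · rw [bits_cons, hv]; cases k <;> rfl
      · simp [hv]
      · simp; omega
    · refine (Exec.loop_true rfl (.block (s' := { s with
        xs := bits l g
        ys := some (g v) :: s.ys
        olim := none :: s.olim }) fun k => ?_) (ih { s with
          ys := some (g v) :: s.ys, olim := none :: s.olim })).of_eq ?_ ?_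
      · rw [bits_cons, hv]; cases k <;> rfl
      · simp [hv, List.replicate_succ']
      · simp; omega

/-- The main loop of the multiplication. -/
def mulLoop : Prg :=
  .loop (fun T => (T .lim).isSome)
    (.seq (.block (.seq (.pop .lim) (.push .olim fun _ => none)))
      (.seq countLoop (pour .ys .xs)))

/-- Each mark of `lim` yields one mark plus one for every set bit, hence the factor `countP + 1`;
the bits travel to `ys` and back. -/
theorem exec_mulLoop (m : ℕ) (l : List V) (g : V → Bool) (s : State) :
    Exec mulLoop
      { s with xs := bits l g, ys := [], lim := List.replicate m none }
      { s with
        xs := bits l g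
        ys := []
        lim := []
        olim := List.replicate (m * (l.countP g + 1)) none ++ s.olim }
      (m * (4 * l.length + 4) + 1) := by
  induction m generalizing s with
  | zero => exact (Exec.loop_false rfl).of_eq (by simp) (by simp)
  | succ m ih =>
    refine (Exec.loop_true rfl (.seq (.block (s' := { s with
        xs := bits l g
        ys := []
        lim := List.replicate m none
        olim := none :: s.olim }) fun k => ?_)
      (.seq (exec_countLoop l g { s with
        ys := []
        lim := List.replicate m none
        olim := none :: s.olim })
        (exec_pour (by decide) _ { s with
          xs := bits l g
          ys := []
          lim := List.replicate m none
          olim := List.replicate (l.countP g) none ++ none :: s.olim } ?_)))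
      (ih { s with olim := List.replicate (l.countP g) none ++ none :: s.olim })).of_eq ?_ ?_
    · rw [List.replicate_succ]; cases k <;> rfl
    · funext k; cases k <;> first | rfl | simp [State.store]
    · have : List.replicate ((m + 1) * (l.countP g + 1)) (none : Sym) =
          List.replicate (m * (l.countP g + 1)) none ++ List.replicate (l.countP g) none ++ [none] := by
        rw [show (m + 1) * (l.countP g + 1) = m * (l.countP g + 1) + l.countP g + 1 by ring,
          List.replicate_succ', List.replicate_add]
      rw [this]
      simp only [List.append_assoc, List.cons_append, List.nil_append]
    · simp [State.store]; ring_nf; omega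

/-- Multiply the length of `lim` by the number of set bits in `xs` plus one. -/
def mulLim : Prg := .seq mulLoop (pour .olim .lim)

theorem exec_mulLim (m : ℕ) (l : List V) (g : V → Bool) (s : State) :
    Exec mulLim
      { s with xs := bits l g, ys := [], lim := List.replicate m none, olim := [] }
      { s with
        xs := bits l g
        ys := []
        lim := List.replicate (m * (l.countP g + 1)) none
        olim := [] }
      (6 * m * (l.length + 1) + 2) := by
  refine (Exec.seq (exec_mulLoop m l g { s with olim := [] })
    (exec_pour (by decide) _ { s with
        xs := bits l g
        ys := []
        lim := List.replicate (m * (l.countP g + 1)) none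
        olim := [] } ?_)).mono ?_
  · funext k; cases k <;> first | rfl | simp [State.store]
  · have := List.countP_le_length (p := g) (l := l)
    simp [State.store]
    nlinarith

/-- Repeat a program. -/
def iter (c : Prg) : ℕ → Prg
  | 0 => .block .skip
  | m + 1 => .seq c (iter c m)

theorem exec_iter_mulLim (d m : ℕ) (l : List V) (g : V → Bool) (s : State) :
    Exec (iter mulLim d)
      { s with xs := bits l g, ys := [], lim := List.replicate m none, olim := [] }
      { s with
        xs := bits l g
        ys := []
        lim := List.replicate (m * (l.countP g + 1) ^ d) none
        olim := [] }
      (d * (6 * m * (l.length + 1) ^ d + 2) + 1) := by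
  induction d generalizing m with
  | zero => exact (Exec.block fun k => rfl).of_eq (by simp) (by simp)
  | succ d ih =>
    refine (Exec.seq (exec_mulLim m l g s) (ih _)).of_eq (by rw [pow_succ']; ring_nf) ?_
    have h1 : m * (l.countP g + 1) ≤ m * (l.length + 1) :=
      Nat.mul_le_mul_left _ (Nat.succ_le_succ List.countP_le_length)
    have h2 : 6 * (m * (l.countP g + 1)) * (l.length + 1) ^ d ≤ 6 * m * (l.length + 1) ^ (d + 1) := by
      calc _ ≤ 6 * (m * (l.length + 1)) * (l.length + 1) ^ d := by gcongr
        _ = _ := by ring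
    have h3 : 6 * m * (l.length + 1) ≤ 6 * m * (l.length + 1) ^ (d + 1) :=
      Nat.mul_le_mul_left _ (Nat.le_self_pow (by omega) _)
    have h4 := Nat.mul_le_mul_left d (Nat.add_le_add_right h2 2)
    rw [add_mul, one_mul]
    omega

end KernelProgram

namespace KernelProgram

open StackLang

variable {V : Type}

/-! #### Comparing a vertex with all others -/

/-- Skip as many symbols of the input as `pos` has. -/
def skipPos : Prg := .loop (fun T => (T .pos).isSome) (.block (.seq (mv .inp .rev) (mv .pos .opos)))

theorem exec_skipPos (l : List V) (g : V → Bool) (r : List Sym) (s : State) :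
    Exec skipPos { s with inp := bits l g ++ r, pos := List.replicate l.length none }
      { s with
        inp := r
        rev := (bits l g).reverse ++ s.rev
        pos := []
        opos := List.replicate l.length none ++ s.opos } (2 * l.length + 1) := by
  induction l generalizing s with
  | nil => exact Exec.loop_false rfl
  | cons v l ih =>
    refine (Exec.loop_true rfl (.block (s' := { s with
        inp := bits l g ++ r
        rev := some (g v) :: s.rev
        pos := List.replicate l.length none
        opos := none :: s.opos }) fun k => ?_)
      (ih { s with rev := some (g v) :: s.rev, opos := none :: s.opos })).of_eq ?_ ?_
    · cases k <;> rfl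
    · simp [List.replicate_succ']
    · simp; omega

/-- The new exclusion bit: `e` is the old one, `r` the adjacency of the vertex, `f` the required
adjacency. -/
def zipBit : Option Sym → Option Sym → Option Sym → Sym
  | some (some e), some (some r), some (some f) => some (e || (r != f))
  | _, _, _ => none

/-- Combine the exclusion bits in `cur` with the adjacencies in the input. -/
def zip : Prg :=
  .loop (fun T => (T .cur).isSome)
    (.block (.seq (.push .done fun T => zipBit (T .cur) (T .inp) (T .flag))
      (.seq (mv .inp .rev) (mv .cur .old))))

theorem exec_zip (l : List V) (e g : V → Bool) (f : Bool) (r F : List Sym) (s : State) :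
    Exec zip { s with inp := bits l g ++ r, cur := bits l e, flag := some f :: F }
      { s with
        inp := r
        rev := (bits l g).reverse ++ s.rev
        cur := []
        old := (bits l e).reverse ++ s.old
        flag := some f :: F
        done := (bits l fun u => e u || (g u != f)).reverse ++ s.done } (2 * l.length + 1) := by
  induction l generalizing s with
  | nil => exact Exec.loop_false rfl
  | cons v l ih =>
    refine (Exec.loop_true rfl (.block (s' := { s with
        inp := bits l g ++ r
        rev := some (g v) :: s.rev
        cur := bits l e
        old := some (e v) :: s.old
        flag := some f :: F
        done := some (e v || (g v != f)) :: s.done }) fun k => ?_)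
      (ih { s with
        rev := some (g v) :: s.rev
        old := some (e v) :: s.old
        done := some (e v || (g v != f)) :: s.done })).of_eq ?_ ?_
    · cases k <;> rfl
    · simp
    · simp; omega

/-- Combine the exclusion bits in `cur` with one row of the input. -/
def zipRow : Prg :=
  .seq (.block (.seq (mv .inp .rev) (.seq (mv .inp .rev) (.push .done fun _ => none))))
    (.seq skipPos (.seq (pour .opos .pos)
      (.seq (.block (.seq (.push .flag fun T => (T .inp).getD none) (mv .inp .rev)))
        (.seq zip (.seq (pour .old .cur) (.block (.pop .flag)))))))

/-- The exclusion bits of the vertices after the current one, on the stacks `todo` and `done`. -/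
def item (post : List V) (e : V → Bool) : List Sym := (bits post e).reverse ++ [none]

/-- Exclude the vertices whose adjacency to `y` differs from that of `v`. -/
def exclude (a : V → V → Bool) (v : V) (e : V → Bool) (y : V) : V → Bool :=
  fun u => e u || (a y u != a y v)

/-- `pos` holds the index of v in unary. Skipping that many bits of the row of y exposes the
adjacency of y and v, which becomes the required value on `flag`; the bits that remain in the row
are aligned with `cur`. -/
theorem exec_zipRow (pre post : List V) (v y : V) (x : V → Bool) (a : V → V → Bool) (e : V → Bool)
    (es : List (V → Bool)) (r : List Sym) (s : State) :
    Exec zipRow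
      { s with
        inp := row (pre ++ v :: post) x a y ++ r
        cur := bits post e
        old := []
        done := es.flatMap (item post)
        pos := List.replicate pre.length none
        opos := [] }
      { s with
        inp := r
        rev := (row (pre ++ v :: post) x a y).reverse ++ s.rev
        cur := bits post e
        old := []
        done := (exclude a v e y :: es).flatMap (item post)
        pos := List.replicate pre.length none
        opos := [] }
      (4 * (pre ++ v :: post).length + 3) := by
  refine (Exec.seq (.block (s' := { s with
      inp := bits pre (a y) ++ (some (a y v) :: bits post (a y) ++ r)
      rev := some (x y) :: none :: s.rev
      cur := bits post e
      old := []
      done := none :: es.flatMap (item post)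
      pos := List.replicate pre.length none
      opos := [] }) fun k => ?_)
    (.seq (exec_skipPos pre (a y) (some (a y v) :: bits post (a y) ++ r) { s with
      rev := some (x y) :: none :: s.rev
      cur := bits post e
      old := []
      done := none :: es.flatMap (item post)
      opos := [] })
    (.seq (exec_pour (by decide) _ { s with
      inp := some (a y v) :: bits post (a y) ++ r
      rev := (bits pre (a y)).reverse ++ some (x y) :: none :: s.rev
      cur := bits post e
      old := []
      done := none :: es.flatMap (item post)
      pos := List.replicate pre.length none
      opos := [] } ?_)
    (.seq (.block (s' := { s with
      inp := bits post (a y) ++ r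
      rev := some (a y v) :: ((bits pre (a y)).reverse ++ some (x y) :: none :: s.rev)
      cur := bits post e
      old := []
      flag := some (a y v) :: s.flag
      done := none :: es.flatMap (item post)
      pos := List.replicate pre.length none
      opos := [] }) fun k => ?_)
    (.seq (exec_zip post e (a y) (a y v) r s.flag { s with
      rev := some (a y v) :: ((bits pre (a y)).reverse ++ some (x y) :: none :: s.rev)
      old := []
      done := none :: es.flatMap (item post)
      pos := List.replicate pre.length none
      opos := [] })
    (.seq (exec_pour (by decide) _ { s with
      inp := r
      rev := (row (pre ++ v :: post) x a y).reverse ++ s.rev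
      cur := bits post e
      old := []
      flag := some (a y v) :: s.flag
      done := (exclude a v e y :: es).flatMap (item post)
      pos := List.replicate pre.length none
      opos := [] } ?_) (.block fun k => ?_))))))).mono ?_
  · rw [row, bits_append, bits_cons]
    cases k <;> first | rfl | simp [State.store, mv, Block.exec, tops]
  · funext k; cases k <;> first | rfl | simp [State.store]
  · cases k <;> rfl
  · funext k; cases k <;> first | rfl | (simp [State.store, row, item]; try rfl)
  · cases k <;> rfl
  · simp [State.store]; omega

/-- Combine the exclusion bits in `cur` with all rows of the input. -/
def zipRows : Prg := .loop (fun T => (T .inp).isSome) zipRow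

theorem exec_zipRows (pre post l : List V) (v : V) (x : V → Bool) (a : V → V → Bool)
    (e : V → Bool) (es : List (V → Bool)) (s : State) :
    Exec zipRows
      { s with
        inp := l.flatMap (row (pre ++ v :: post) x a)
        cur := bits post e
        old := []
        done := es.flatMap (item post)
        pos := List.replicate pre.length none
        opos := [] }
      { s with
        inp := []
        rev := (l.flatMap (row (pre ++ v :: post) x a)).reverse ++ s.rev
        cur := bits post e
        old := []
        done := ((l.map (exclude a v e)).reverse ++ es).flatMap (item post)
        pos := List.replicate pre.length none
        opos := [] }
      (l.length * (4 * (pre ++ v :: post).length + 4) + 1) := by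
  induction l generalizing s es with
  | nil => exact (Exec.loop_false rfl).mono (by simp)
  | cons y l ih =>
    rw [List.flatMap_cons]
    refine (Exec.loop_true rfl (exec_zipRow pre post v y x a e es _ s)
      (ih (exclude a v e y :: es) { s with
        rev := (row (pre ++ v :: post) x a y).reverse ++ s.rev })).of_eq ?_ ?_
    · simp
    · rw [List.length_cons, add_mul, one_mul]
      omega

/-- Move the bits on top of `todo` to `cur`. -/
def takeBits : Prg := .loop (fun T => (T .todo).getD none |>.isSome) (.block (mv .todo .cur))

theorem exec_takeBits (l : List V) (g : V → Bool) (r : List Sym) (s : State) :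
    Exec takeBits { s with todo := bits l g ++ none :: r }
      { s with todo := none :: r, cur := (bits l g).reverse ++ s.cur } (2 * l.length + 1) := by
  induction l generalizing s with
  | nil => exact Exec.loop_false rfl
  | cons v l ih =>
    refine (Exec.loop_true rfl (.block (s' := { s with
        todo := bits l g ++ none :: r
        cur := some (g v) :: s.cur }) fun k => ?_)
      (ih { s with cur := some (g v) :: s.cur })).of_eq ?_ ?_
    · cases k <;> rfl
    · simp
    · simp; omega

/-- Combine all exclusion bits in `todo` with all rows of the input. -/
def expandLoop : Prg :=
  .loop (fun T => (T .todo).isSome)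
    (.seq takeBits (.seq (.block (.pop .todo))
      (.seq zipRows (.seq (pour .rev .inp) (clear .cur)))))

theorem exec_expandLoop (pre post : List V) (v : V) (x : V → Bool) (a : V → V → Bool)
    (todo es : List (V → Bool)) (s : State) :
    Exec expandLoop
      { s with
        inp := (pre ++ v :: post).flatMap (row (pre ++ v :: post) x a)
        rev := []
        todo := todo.flatMap (item post)
        cur := []
        old := []
        done := es.flatMap (item post)
        pos := List.replicate pre.length none
        opos := [] }
      { s with
        inp := (pre ++ v :: post).flatMap (row (pre ++ v :: post) x a)
        rev := []
        todo := []
        cur := []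
        old := []
        done := ((todo.flatMap fun e => (pre ++ v :: post).map (exclude a v e)).reverse ++
          es).flatMap (item post)
        pos := List.replicate pre.length none
        opos := [] }
      (todo.length * (6 * ((pre ++ v :: post).length + 1) ^ 2) + 1) := by
  induction todo generalizing s es with
  | nil => exact (Exec.loop_false rfl).mono (by simp)
  | cons e todo ih =>
    have h := exec_takeBits post.reverse e (todo.flatMap (item post)) { s with
        inp := (pre ++ v :: post).flatMap (row (pre ++ v :: post) x a)
        rev := []
        cur := []
        old := []
        done := es.flatMap (item post)
        pos := List.replicate pre.length none
        opos := [] }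
    rw [bits_reverse, List.reverse_reverse] at h
    have ht : (e :: todo).flatMap (item post) =
        (bits post e).reverse ++ none :: todo.flatMap (item post) := by simp [item]
    rw [ht]
    refine (Exec.loop_true ?_ (.seq h (.seq (.block (s' := { s with
        inp := (pre ++ v :: post).flatMap (row (pre ++ v :: post) x a)
        rev := []
        todo := todo.flatMap (item post)
        cur := bits post e
        old := []
        done := es.flatMap (item post)
        pos := List.replicate pre.length none
        opos := [] }) fun k => ?_)
      (.seq (exec_zipRows pre post (pre ++ v :: post) v x a e es { s with
        rev := []
        todo := todo.flatMap (item post) })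
      (.seq (exec_pour (by decide) _ { s with
        inp := (pre ++ v :: post).flatMap (row (pre ++ v :: post) x a)
        rev := []
        todo := todo.flatMap (item post)
        cur := bits post e
        old := []
        done := (((pre ++ v :: post).map (exclude a v e)).reverse ++ es).flatMap (item post)
        pos := List.replicate pre.length none
        opos := [] } ?_)
      (exec_clear _ { s with
        inp := (pre ++ v :: post).flatMap (row (pre ++ v :: post) x a)
        rev := []
        todo := todo.flatMap (item post)
        cur := []
        old := []
        done := (((pre ++ v :: post).map (exclude a v e)).reverse ++ es).flatMap (item post)
        pos := List.replicate pre.length none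
        opos := [] } ?_)))))
      (ih (((pre ++ v :: post).map (exclude a v e)).reverse ++ es) s)).of_eq ?_ ?_
    · simp [tops, State.store]
    · cases k <;> first | rfl | simp [State.store, Block.exec]
    · funext k; cases k <;> first | rfl | simp [State.store]
    · funext k; cases k <;> rfl
    · simp
    · simp only [State.store, List.append_nil, List.length_reverse, length_flatMap_row,
        length_bits, List.length_cons]
      have : post.length + 1 ≤ (pre ++ v :: post).length := by simp
      generalize (pre ++ v :: post).length = n at *
      nlinarith

/-- Combine all exclusion bits in `todo` with all rows of the input, and store the results in
`todo`. -/
def expand : Prg := .seq expandLoop (.seq (pour .done .old) (pour .old .todo))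

/-- The result of `expand`. -/
def expansion (vs : List V) (a : V → V → Bool) (v : V) (todo : List (V → Bool)) : List (V → Bool) :=
  (todo.flatMap fun e => vs.map (exclude a v e)).reverse

theorem length_expansion (vs : List V) (a : V → V → Bool) (v : V) (todo : List (V → Bool)) :
    (expansion vs a v todo).length = todo.length * vs.length := by
  simp [expansion, List.length_flatMap]

theorem length_flatMap_item (post : List V) (es : List (V → Bool)) :
    (es.flatMap (item post)).length = es.length * (post.length + 1) := by
  simp [List.length_flatMap, item]

theorem exec_expand (pre post : List V) (v : V) (x : V → Bool) (a : V → V → Bool)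
    (todo : List (V → Bool)) (s : State) :
    Exec expand
      { s with
        inp := (pre ++ v :: post).flatMap (row (pre ++ v :: post) x a)
        rev := []
        todo := todo.flatMap (item post)
        cur := []
        old := []
        done := []
        pos := List.replicate pre.length none
        opos := [] }
      { s with
        inp := (pre ++ v :: post).flatMap (row (pre ++ v :: post) x a)
        rev := []
        todo := (expansion (pre ++ v :: post) a v todo).flatMap (item post)
        cur := []
        old := []
        done := []
        pos := List.replicate pre.length none
        opos := [] }
      (todo.length * (10 * ((pre ++ v :: post).length + 1) ^ 2) + 3) := by
  refine (Exec.seq (exec_expandLoop pre post v x a todo [] s)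
    -- A single pour would put the end mark of each item on top of its bits; the second one turns
    -- the items back.
    (.seq (exec_pour (by decide) _ { s with
        inp := (pre ++ v :: post).flatMap (row (pre ++ v :: post) x a)
        rev := []
        todo := []
        cur := []
        old := ((expansion (pre ++ v :: post) a v todo).flatMap (item post)).reverse
        done := []
        pos := List.replicate pre.length none
        opos := [] } ?_)
      (exec_pour (by decide) _ { s with
        inp := (pre ++ v :: post).flatMap (row (pre ++ v :: post) x a)
        rev := []
        todo := (expansion (pre ++ v :: post) a v todo).flatMap (item post)
        cur := []
        old := []
        done := []
        pos := List.replicate pre.length none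
        opos := [] } ?_))).mono ?_
  · rw [List.append_nil]
    funext k; cases k <;> first | rfl | simp [State.store, expansion]
  · funext k; cases k <;> first | rfl | simp [State.store]
  · have h := length_flatMap_item post (expansion (pre ++ v :: post) a v todo)
    rw [length_expansion] at h
    have h' : (((todo.flatMap fun e => (pre ++ v :: post).map (exclude a v e)).reverse ++
        []).flatMap (item post)).length = todo.length * (pre ++ v :: post).length *
          (post.length + 1) := by rw [List.append_nil]; exact h
    simp only [State.store, List.length_reverse, h, h']
    have : post.length + 1 ≤ (pre ++ v :: post).length := by simp
    generalize (pre ++ v :: post).length = n at *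
    have h1 : todo.length * n * (post.length + 1) ≤ todo.length * n * n := Nat.mul_le_mul_left _ this
    nlinarith

/-- The last of the d rounds handles a number of lists proportional to n^(d-1), each at quadratic
cost, whence the exponent d + 1. -/
theorem exec_iter_expand (d : ℕ) (pre post : List V) (v : V) (x : V → Bool) (a : V → V → Bool)
    (todo : List (V → Bool)) (s : State) :
    Exec (iter expand d)
      { s with
        inp := (pre ++ v :: post).flatMap (row (pre ++ v :: post) x a)
        rev := []
        todo := todo.flatMap (item post)
        cur := []
        old := []
        done := []
        pos := List.replicate pre.length none
        opos := [] }
      { s with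
        inp := (pre ++ v :: post).flatMap (row (pre ++ v :: post) x a)
        rev := []
        todo := ((expansion (pre ++ v :: post) a v)^[d] todo).flatMap (item post)
        cur := []
        old := []
        done := []
        pos := List.replicate pre.length none
        opos := [] }
      (d * (todo.length * (10 * ((pre ++ v :: post).length + 1) ^ (d + 1)) + 3) + 1) := by
  induction d generalizing todo with
  | zero => exact (Exec.block fun k => rfl).mono (by simp)
  | succ d ih =>
    refine (Exec.seq (exec_expand pre post v x a todo s) (ih _)).mono ?_
    rw [length_expansion]
    generalize (pre ++ v :: post).length = n
    have h2 : todo.length * n * (10 * (n + 1) ^ (d + 1)) ≤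
        todo.length * (10 * (n + 1) ^ (d + 1 + 1)) := by
      calc _ ≤ todo.length * (n + 1) * (10 * (n + 1) ^ (d + 1)) := by gcongr; omega
        _ = _ := by ring
    have h3 : todo.length * (10 * (n + 1) ^ 2) ≤ todo.length * (10 * (n + 1) ^ (d + 1 + 1)) := by
      gcongr <;> omega
    have h4 := Nat.mul_le_mul_left d (Nat.add_le_add_right h2 3)
    rw [add_mul d 1, one_mul]
    omega

end KernelProgram

namespace KernelProgram

open StackLang

variable {V : Type}

/-- Move all symbols of `k` to `l` and to `m`. -/
def copy (k l m : Stk) : Prg :=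
  .loop (fun T => (T k).isSome) (.block (.seq (.push m fun T => (T k).getD none) (mv k l)))

theorem run_copy {k l m : Stk} (hkl : k ≠ l) (hkm : k ≠ m) (hlm : l ≠ m) (w : List Sym)
    (s : Store Stk Sym) (hw : s k = w) :
    Run (copy k l m) s (Function.update (Function.update (Function.update s m (w.reverse ++ s m))
      l (w.reverse ++ s l)) k []) (2 * w.length + 1) := by
  induction w generalizing s with
  | nil =>
    have : Function.update (Function.update (Function.update s m (([] : List Sym).reverse ++ s m))
        l (([] : List Sym).reverse ++ s l)) k [] = s := by
      rw [List.reverse_nil, List.nil_append, List.nil_append, Function.update_eq_self,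
        Function.update_eq_self, ← hw, Function.update_eq_self]
    rw [this]
    exact .loop_false (by simp [tops, hw])
  | cons a w ih =>
    have hb : (Block.seq (.push m fun T => (T k).getD none) (mv k l)).exec s =
        Function.update (Function.update (Function.update s m (a :: s m)) l (a :: s l)) k w := by
      simp [mv, Block.exec, tops, hw, Function.update_of_ne hkl, Function.update_of_ne hkm,
        Function.update_of_ne hlm]
    have h := ih (Function.update (Function.update (Function.update s m (a :: s m)) l (a :: s l))
      k w) (by simp)
    have he : Function.update (Function.update (Function.update
        (Function.update (Function.update (Function.update s m (a :: s m)) l (a :: s l)) k w)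
        m (w.reverse ++ (Function.update (Function.update (Function.update s m (a :: s m))
          l (a :: s l)) k w) m))
        l (w.reverse ++ (Function.update (Function.update (Function.update s m (a :: s m))
          l (a :: s l)) k w) l)) k [] =
        Function.update (Function.update (Function.update s m ((a :: w).reverse ++ s m))
          l ((a :: w).reverse ++ s l)) k [] := by
      funext j
      by_cases hjk : j = k
      · subst hjk; simp
      · by_cases hjl : j = l
        · subst hjl; simp [hjk]
        · by_cases hjm : j = m
          · subst hjm; simp [hjk, hjl]
          · simp [hjk, hjl, hjm]
    rw [he] at h
    exact (Run.loop_true (by simp [tops, hw]) (hb ▸ Run.block _ s) h).mono (by simp; omega)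

theorem exec_copy {k l m : Stk} (hkl : k ≠ l) (hkm : k ≠ m) (hlm : l ≠ m) (s s' : State)
    (h : Function.update (Function.update (Function.update s.store m
      ((s.store k).reverse ++ s.store m)) l ((s.store k).reverse ++ s.store l)) k [] = s'.store) :
    Exec (copy k l m) s s' (2 * (s.store k).length + 1) := by
  have := run_copy hkl hkm hlm _ s.store rfl
  rwa [h] at this

/-! #### Comparing the numbers of similar vertices with the limit -/

/-- Move one mark from `lim` to `olim` for every zero on top of `todo`. -/
def checkBits : Prg :=
  .loop (fun T => (T .todo).getD none |>.isSome)
    (.block (.seq (.ite (fun T => T .todo == some (some false)) (mv .lim .olim) .skip)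
      (.pop .todo)))

/-- The truncated subtraction is intended: once `lim` is empty, further zeros move nothing. So `lim`
stays nonempty exactly when there are fewer than m zeros, and `olim` holds what is needed to restore
it. -/
theorem exec_checkBits (l : List V) (e : V → Bool) (r : List Sym) (m : ℕ) (s : State) :
    Exec checkBits { s with todo := bits l e ++ none :: r, lim := List.replicate m none }
      { s with
        todo := none :: r
        lim := List.replicate (m - l.countP fun u => !e u) none
        olim := List.replicate (m - (m - l.countP fun u => !e u)) none ++ s.olim }
      (2 * l.length + 1) := by
  induction l generalizing s m with
  | nil => exact (Exec.loop_false rfl).of_eq (by simp) (by simp)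
  | cons v l ih =>
    cases hv : e v
    · cases m with
      | zero =>
        refine (Exec.loop_true rfl (.block (s' := { s with
            todo := bits l e ++ none :: r
            lim := List.replicate 0 none }) fun k => ?_) (ih 0 s)).of_eq ?_ ?_
        · rw [bits_cons, hv]; cases k <;> rfl
        · simp
        · simp; omega
      | succ m =>
        refine (Exec.loop_true rfl (.block (s' := { s with
            todo := bits l e ++ none :: r
            lim := List.replicate m none
            olim := none :: s.olim }) fun k => ?_) (ih m { s with olim := none :: s.olim })).of_eq
              ?_ ?_
        · rw [bits_cons, hv, List.replicate_succ]; cases k <;> rfl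
        · have h1 : m + 1 - List.countP (fun u => !e u) (v :: l) =
              m - List.countP (fun u => !e u) l := by
            rw [List.countP_cons_of_pos (by simp [hv])]; omega
          have h2 : m + 1 - (m - List.countP (fun u => !e u) l) =
              m - (m - List.countP (fun u => !e u) l) + 1 := by omega
          rw [h1, h2, List.replicate_succ']
          simp
        · simp; omega
    · refine (Exec.loop_true rfl (.block (s' := { s with
            todo := bits l e ++ none :: r
            lim := List.replicate m none }) fun k => ?_) (ih m s)).of_eq ?_ ?_
      · rw [bits_cons, hv]; cases k <;> rfl
      · simp [hv]
      · simp; omega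

/-- A mark if `b` is true. -/
def mark (b : Bool) : List Sym := cond b [none] []

/-- Put a mark on `found` if one of the lists in `todo` has less zeros than the limit. -/
def check : Prg :=
  .loop (fun T => (T .todo).isSome)
    (.seq checkBits
      (.seq (.block (.seq (.pop .todo)
        (.ite (fun T => (T .lim).isSome && (T .found).isNone) (.push .found fun _ => none) .skip)))
      (pour .olim .lim)))

/-- Some list has less than `m` zeros. -/
def isSparse (post : List V) (m : ℕ) (es : List (V → Bool)) : Bool :=
  es.any fun e => decide ((post.countP fun u => !e u) < m)

theorem exec_check (post : List V) (es : List (V → Bool)) (m : ℕ) (b : Bool) (s : State) :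
    Exec check
      { s with
        todo := es.flatMap (item post)
        lim := List.replicate m none
        olim := []
        found := mark b }
      { s with
        todo := []
        lim := List.replicate m none
        olim := []
        found := mark (b || isSparse post m es) }
      (es.length * (2 * post.length + 2 * m + 4) + 1) := by
  induction es generalizing b with
  | nil => exact (Exec.loop_false rfl).of_eq (by simp [isSparse]) (by simp)
  | cons e es ih =>
    have h := exec_checkBits post.reverse e (es.flatMap (item post)) m { s with
      olim := [], found := mark b }
    rw [bits_reverse, List.countP_reverse] at h
    have ht : (e :: es).flatMap (item post) =
        (bits post e).reverse ++ none :: es.flatMap (item post) := by simp [item]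
    rw [ht]
    set c := post.countP fun u => !e u with hc
    refine (Exec.loop_true ?_ (.seq h (.seq (.block (s' := { s with
        todo := es.flatMap (item post)
        lim := List.replicate (m - c) none
        olim := List.replicate (m - (m - c)) none ++ []
        found := mark (b || decide (c < m)) }) fun k => ?_)
      (exec_pour (by decide) _ { s with
        todo := es.flatMap (item post)
        lim := List.replicate m none
        olim := []
        found := mark (b || decide (c < m)) } ?_)))
      (ih (b || decide (c < m)))).of_eq ?_ ?_
    · simp [tops, State.store]
    · by_cases hcm : c < m
      · obtain ⟨i, hi⟩ : ∃ i, m - c = i + 1 := ⟨m - c - 1, by omega⟩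
        rw [hi, List.replicate_succ]
        cases b <;> simp only [hcm, decide_true] <;> cases k <;> rfl
      · have hi : m - c = 0 := by omega
        rw [hi]
        cases b <;> simp only [hcm, decide_false] <;> cases k <;> rfl
    · have : m - (m - c) + (m - c) = m := by omega
      funext k; cases k <;> first | rfl | simp [State.store, this]
    · simp [isSparse, ← hc, Bool.or_assoc]
    · simp [State.store]
      ring_nf
      omega

/-! #### The vertices to be kept -/

/-- Decide whether a vertex outside of the vertex cover is kept. -/
def decideVertex (d : ℕ) : Prg :=
  .seq (.block (.seq (.pop .xs) (.push .todo fun _ => none)))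
    (.seq (copy .xs .ys .todo) (.seq (pour .ys .xs) (.seq (iter expand d) (.seq check
      (.block (.seq (.ite (fun T => (T .found).isSome) (.push .keep fun _ => some true)
          (.push .keep fun _ => some false))
        (.seq (.pop .found) (.push .pos fun _ => none))))))))

/-- Decide which vertices are kept. -/
def mainLoop (d : ℕ) : Prg :=
  .loop (fun T => (T .xs).isSome)
    (.ite (fun T => T .xs == some (some true))
      (.block (.seq (.pop .xs) (.seq (.push .keep fun _ => some true)
        (.push .pos fun _ => none))))
      (decideVertex d))

/-- The vertex `v`, which the vertices in `post` follow, is kept. -/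
def isKept (vs post : List V) (x : V → Bool) (a : V → V → Bool) (d m : ℕ) (v : V) : Bool :=
  x v || isSparse post m ((expansion vs a v)^[d] [x])

/-- A bound on the running time of `decideVertex`. -/
def vertexTime (n d m : ℕ) : ℕ :=
  d * (10 * (n + 1) ^ (d + 1) + 3) + (n + 1) ^ d * (2 * n + 2 * m + 4) + 4 * n + 6

theorem length_iterate_expansion (vs : List V) (a : V → V → Bool) (v : V) (d : ℕ)
    (es : List (V → Bool)) :
    ((expansion vs a v)^[d] es).length = es.length * vs.length ^ d := by
  induction d generalizing es with
  | zero => simp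
  | succ d ih => rw [Function.iterate_succ_apply, ih, length_expansion]; ring

/-- The first exclusion list is `x` itself, so cover vertices are never counted as similar. The bits
`x` steer the decision while `y` is what the input rows contain; the two may differ when the cover
is ignored. -/
theorem exec_decideVertex (d m : ℕ) (pre post : List V) (v : V) (x y : V → Bool)
    (a : V → V → Bool) (hv : x v = false) (s : State) :
    Exec (decideVertex d)
      { s with
        inp := (pre ++ v :: post).flatMap (row (pre ++ v :: post) y a)
        rev := []
        xs := bits (v :: post) x
        ys := []
        todo := []
        cur := []
        old := []
        done := []
        pos := List.replicate pre.length none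
        opos := []
        lim := List.replicate m none
        olim := []
        found := [] }
      { s with
        inp := (pre ++ v :: post).flatMap (row (pre ++ v :: post) y a)
        rev := []
        xs := bits post x
        ys := []
        keep := some (isKept (pre ++ v :: post) post x a d m v) :: s.keep
        todo := []
        cur := []
        old := []
        done := []
        pos := List.replicate (pre ++ [v]).length none
        opos := []
        lim := List.replicate m none
        olim := []
        found := [] }
      (vertexTime (pre ++ v :: post).length d m) := by
  refine (Exec.seq (.block (s' := { s with
        inp := (pre ++ v :: post).flatMap (row (pre ++ v :: post) y a)
        rev := []
        xs := bits post x
        ys := []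
        todo := [none]
        cur := []
        old := []
        done := []
        pos := List.replicate pre.length none
        opos := []
        lim := List.replicate m none
        olim := []
        found := [] }) fun k => ?_)
    (.seq (exec_copy (by decide) (by decide) (by decide) _ { s with
        inp := (pre ++ v :: post).flatMap (row (pre ++ v :: post) y a)
        rev := []
        xs := []
        ys := (bits post x).reverse
        todo := [x].flatMap (item post)
        cur := []
        old := []
        done := []
        pos := List.replicate pre.length none
        opos := []
        lim := List.replicate m none
        olim := []
        found := [] } ?_)
    (.seq (exec_pour (by decide) _ { s with
        inp := (pre ++ v :: post).flatMap (row (pre ++ v :: post) y a)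
        rev := []
        xs := bits post x
        ys := []
        todo := [x].flatMap (item post)
        cur := []
        old := []
        done := []
        pos := List.replicate pre.length none
        opos := []
        lim := List.replicate m none
        olim := []
        found := [] } ?_)
    (.seq (exec_iter_expand d pre post v y a [x] { s with
        xs := bits post x
        ys := []
        lim := List.replicate m none
        olim := []
        found := [] })
    (.seq (exec_check post _ m false { s with
        inp := (pre ++ v :: post).flatMap (row (pre ++ v :: post) y a)
        rev := []
        xs := bits post x
        ys := []
        cur := []
        old := []
        done := []
        pos := List.replicate pre.length none
        opos := [] })
    (.block fun k => ?_)))))).mono ?_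
  · cases k <;> rfl
  · funext k; cases k <;> first | rfl | simp [State.store, item]
  · funext k; cases k <;> first | rfl | simp [State.store]
  · rw [isKept, hv, List.length_append, List.length_singleton, List.replicate_succ]
    cases isSparse post m ((expansion (pre ++ v :: post) a v)^[d] [x]) <;> cases k <;> rfl
  · rw [length_iterate_expansion]
    have : post.length + 1 ≤ (pre ++ v :: post).length := by simp
    simp only [State.store, length_bits, List.length_reverse, List.length_singleton, vertexTime]
    generalize (pre ++ v :: post).length = n at *
    have h : n ^ d * (2 * post.length + 2 * m + 4) ≤ (n + 1) ^ d * (2 * n + 2 * m + 4) :=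
      Nat.mul_le_mul (Nat.pow_le_pow_left (by omega) _) (by omega)
    rw [one_mul, one_mul]
    omega

theorem exec_mainLoop (d m : ℕ) (vs pre post : List V) (x y κ : V → Bool) (a : V → V → Bool)
    (hvs : vs = pre ++ post)
    (hκ : ∀ pre v post, vs = pre ++ v :: post → κ v = isKept vs post x a d m v) (s : State) :
    Exec (mainLoop d)
      { s with
        inp := vs.flatMap (row vs y a)
        rev := []
        xs := bits post x
        ys := []
        keep := (bits pre κ).reverse
        todo := []
        cur := []
        old := []
        done := []
        pos := List.replicate pre.length none
        opos := []
        lim := List.replicate m none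
        olim := []
        found := [] }
      { s with
        inp := vs.flatMap (row vs y a)
        rev := []
        xs := []
        ys := []
        keep := (bits vs κ).reverse
        todo := []
        cur := []
        old := []
        done := []
        pos := List.replicate vs.length none
        opos := []
        lim := List.replicate m none
        olim := []
        found := [] }
      (post.length * (vertexTime vs.length d m + 2) + 1) := by
  induction post generalizing pre with
  | nil =>
    rw [List.append_nil] at hvs
    subst hvs
    exact (Exec.loop_false rfl).mono (by simp)
  | cons v post ih =>
    have h := ih (pre ++ [v]) (by simp [hvs])
    have hb : (bits (pre ++ [v]) κ).reverse = some (κ v) :: (bits pre κ).reverse := by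
      simp [bits]
    rw [hb] at h
    have hv := hκ pre v post hvs
    cases hx : x v
    · refine (Exec.loop_true rfl (.ite_false ?_ ?_) h
        (t₁ := 1 + vertexTime vs.length d m)).mono ?_
      · simp [tops, State.store, hx]
      · rw [hv, hvs]
        exact exec_decideVertex d m pre post v x y a hx { s with keep := (bits pre κ).reverse }
      · simp only [List.length_cons]; rw [add_mul]; omega
    · refine (Exec.loop_true rfl (.ite_true ?_ (.block fun k => ?_)) h).mono ?_
      · simp [tops, State.store, hx]
      · rw [hv, isKept, hx]
        cases k <;> first | rfl | simp [State.store, Block.exec, List.replicate_succ]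
      · simp only [List.length_cons, vertexTime]; rw [add_mul]; omega

/-! #### Writing the output -/

/-- Write the row of a vertex, without the symbols that belong to deleted vertices. -/
def writeBits : Prg :=
  .loop (fun T => (T .keep).isSome)
    (.block (.seq (.ite (fun T => T .xs == some (some true) && T .keep == some (some true))
        (.push .out fun T => (T .rev).getD none) .skip)
      (.seq (.pop .rev) (mv .keep .ys))))

theorem exec_writeBits (l : List V) (κ g : V → Bool) (b : Bool) (r X : List Sym) (s : State) :
    Exec writeBits { s with rev := bits l g ++ r, xs := some b :: X, keep := bits l κ }
      { s with
        rev := r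
        xs := some b :: X
        ys := (bits l κ).reverse ++ s.ys
        keep := []
        out := cond b ((bits (l.filter κ) g).reverse ++ s.out) s.out } (2 * l.length + 1) := by
  induction l generalizing s with
  | nil => exact (Exec.loop_false rfl).of_eq (by cases b <;> rfl) (by simp)
  | cons v l ih =>
    refine (Exec.loop_true rfl (.block (s' := { s with
        rev := bits l g ++ r
        xs := some b :: X
        ys := some (κ v) :: s.ys
        keep := bits l κ
        out := cond (b && κ v) (some (g v) :: s.out) s.out }) fun k => ?_)
      (ih { s with
        ys := some (κ v) :: s.ys
        out := cond (b && κ v) (some (g v) :: s.out) s.out })).of_eq ?_ ?_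
    · rw [bits_cons, bits_cons]
      cases b <;> cases κ v <;> cases k <;> rfl
    · cases b <;> cases hv : κ v <;> simp [hv]
    · simp; omega

/-- Write one symbol, if the current vertex is kept. -/
def writeHead : Block Stk Sym :=
  .seq (.ite (fun T => T .xs == some (some true)) (.push .out fun T => (T .rev).getD none) .skip)
    (.pop .rev)

/-- Write the output. -/
def writeLoop : Prg :=
  .loop (fun T => (T .xs).isSome)
    (.seq writeBits (.seq (pour .ys .keep) (.block (.seq writeHead (.seq writeHead (.pop .xs))))))

theorem exec_writeLoop (vs l : List V) (x κ : V → Bool) (a : V → V → Bool) (s : State) :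
    Exec writeLoop
      { s with
        rev := (l.flatMap (row vs x a)).reverse
        xs := (bits l κ).reverse
        ys := []
        keep := (bits vs κ).reverse }
      { s with
        rev := []
        xs := []
        ys := []
        keep := (bits vs κ).reverse
        out := (l.filter κ).flatMap (row (vs.filter κ) x a) ++ s.out }
      (l.length * (4 * vs.length + 4) + 1) := by
  -- Rows are consumed from the last vertex to the first, since `rev` is reversed, and pushing them
  -- restores the original order in `out`.
  induction l using List.reverseRecOn generalizing s with
  | nil => exact (Exec.loop_false rfl).of_eq (by simp) (by simp)
  | append_singleton l v ih =>
    have h := exec_writeBits vs.reverse κ (a v) (κ v)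
      (some (x v) :: none :: (l.flatMap (row vs x a)).reverse) (bits l κ).reverse { s with ys := [] }
    have hr : ((l ++ [v]).flatMap (row vs x a)).reverse = bits vs.reverse (a v) ++
        some (x v) :: none :: (l.flatMap (row vs x a)).reverse := by
      simp [row, bits_reverse]
    have hb : (bits (l ++ [v]) κ).reverse = some (κ v) :: (bits l κ).reverse := by simp [bits]
    rw [hr, hb, ← bits_reverse vs]
    refine (Exec.loop_true rfl (.seq h (.seq (exec_pour (by decide) _ { s with
        rev := some (x v) :: none :: (l.flatMap (row vs x a)).reverse
        xs := some (κ v) :: (bits l κ).reverse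
        ys := []
        keep := (bits vs κ).reverse
        out := cond (κ v) (bits (vs.filter κ) (a v) ++ s.out) s.out } ?_)
      (.block (s' := { s with
        rev := (l.flatMap (row vs x a)).reverse
        xs := (bits l κ).reverse
        ys := []
        keep := (bits vs κ).reverse
        out := cond (κ v) (row (vs.filter κ) x a v ++ s.out) s.out }) fun k => ?_)))
      (ih { s with out := cond (κ v) (row (vs.filter κ) x a v ++ s.out) s.out })).of_eq ?_ ?_
    · funext k; cases k <;> first | rfl | simp [State.store, bits_reverse]
    · cases κ v <;> cases k <;> rfl
    · cases hv : κ v <;> simp [hv, bits_reverse]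
    · simp [State.store]; ring_nf; omega

/-! #### The whole program -/

/-- The program that computes the kernel. -/
def program (b : Bool) (m d k : ℕ) : Prg :=
  .seq (scan b) (.seq (pour .rev .inp) (.seq (pour .ys .xs) (.seq (.block (pushMarks .lim m))
    (.seq (iter mulLim d) (.seq (mainLoop k) (.seq (pour .inp .rev) (.seq (pour .keep .ys)
      (.seq (copy .ys .keep .xs) (.seq writeLoop (.seq (clear .keep) (.seq (clear .pos)
        (clear .lim))))))))))))

/-- A bound on the running time. -/
def programTime (m d k n : ℕ) : ℕ :=
  d * (6 * m * (n + 1) ^ d + 2) + n * (vertexTime n k (m * (n + 1) ^ d) + 2) +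
    2 * (m * (n + 1) ^ d) + 10 * (n + 1) ^ 2 + 20 * n + 20

theorem exec_program (b : Bool) (m d k : ℕ) (vs : List V) (x κ : V → Bool) (a : V → V → Bool)
    (hκ : ∀ pre v post, vs = pre ++ v :: post → κ v =
      isKept vs post (fun u => x u && b) a k (m * ((vs.countP fun u => x u && b) + 1) ^ d) v) :
    Exec (program b m d k) { inp := vs.flatMap (row vs x a) }
      { out := (vs.filter κ).flatMap (row (vs.filter κ) x a) } (programTime m d k vs.length) := by
  set M := m * ((vs.countP fun u => x u && b) + 1) ^ d with hM
  have h := exec_writeLoop vs vs x κ a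
    { pos := List.replicate vs.length none, lim := List.replicate M none }
  rw [List.append_nil] at h
  refine (Exec.seq (exec_scan b vs vs x a {})
    (.seq (exec_pour (by decide) _ {
      inp := vs.flatMap (row vs x a)
      ys := (bits vs fun u => x u && b).reverse } ?_)
    (.seq (exec_pour (by decide) _ {
      inp := vs.flatMap (row vs x a)
      xs := bits vs fun u => x u && b } ?_)
    (.seq (.block (s' := {
      inp := vs.flatMap (row vs x a)
      xs := bits vs fun u => x u && b
      lim := List.replicate m none }) fun k => ?_)
    (.seq (exec_iter_mulLim d m vs (fun u => x u && b) { inp := vs.flatMap (row vs x a) })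
    (.seq (exec_mainLoop k M vs [] vs (fun u => x u && b) x κ a rfl hκ {})
    (.seq (exec_pour (by decide) _ {
      rev := (vs.flatMap (row vs x a)).reverse
      keep := (bits vs κ).reverse
      pos := List.replicate vs.length none
      lim := List.replicate M none } ?_)
    (.seq (exec_pour (by decide) _ {
      rev := (vs.flatMap (row vs x a)).reverse
      ys := bits vs κ
      pos := List.replicate vs.length none
      lim := List.replicate M none } ?_)
    (.seq (exec_copy (by decide) (by decide) (by decide) _ {
      rev := (vs.flatMap (row vs x a)).reverse
      xs := (bits vs κ).reverse
      keep := (bits vs κ).reverse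
      pos := List.replicate vs.length none
      lim := List.replicate M none } ?_)
    (.seq h
    (.seq (exec_clear _ {
      pos := List.replicate vs.length none
      lim := List.replicate M none
      out := (vs.filter κ).flatMap (row (vs.filter κ) x a) } ?_)
    (.seq (exec_clear _ {
      lim := List.replicate M none
      out := (vs.filter κ).flatMap (row (vs.filter κ) x a) } ?_)
    (exec_clear _ {
      out := (vs.filter κ).flatMap (row (vs.filter κ) x a) } ?_))))))))))))).mono ?_
  · funext k; cases k <;> first | rfl | simp [State.store]
  · funext k; cases k <;> first | rfl | simp [State.store]
  · refine (congrFun (exec_pushMarks m _) k).trans ?_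
    cases k <;> first | rfl | simp [State.store]
  · funext k; cases k <;> first | rfl | simp [State.store]
  · funext k; cases k <;> first | rfl | simp [State.store]
  · funext k; cases k <;> first | rfl | simp [State.store]
  · funext k; cases k <;> rfl
  · funext k; cases k <;> rfl
  · funext k; cases k <;> rfl
  · have hle : M ≤ m * (vs.length + 1) ^ d := by
      have := List.countP_le_length (p := fun u => x u && b) (l := vs)
      rw [hM]
      gcongr
    have hv : vertexTime vs.length k M ≤ vertexTime vs.length k (m * (vs.length + 1) ^ d) := by
      unfold vertexTime
      gcongr
    have hv' := Nat.mul_le_mul_left vs.length (Nat.add_le_add_right hv 2)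
    simp only [State.store, List.append_nil, List.length_reverse, length_flatMap_row, length_bits,
      List.length_replicate, programTime]
    have : 10 * (vs.length + 1) ^ 2 + 20 * vs.length = 6 * (vs.length * (vs.length + 2)) +
      vs.length * (4 * vs.length + 4) + 24 * vs.length + 10 := by ring
    omega

end KernelProgram

/-! ### The kernel -/

namespace KernelProgram

/-! ### Exclusion lists as tuples of vertices -/

section Expansion

variable {V : Type}

/-- Each round branches over the next entry, so d rounds produce exactly the exclusion functions of
all d-tuples. -/
theorem mem_iterate_expansion (vs : List V) (a : V → V → Bool) (v : V) (d : ℕ)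
    (es : List (V → Bool)) (e : V → Bool) :
    e ∈ (expansion vs a v)^[d] es ↔ ∃ e₀ ∈ es, ∃ ys : List V, ys.length = d ∧ (∀ y ∈ ys, y ∈ vs) ∧
      e = ys.foldl (exclude a v) e₀ := by
  induction d generalizing es with
  | zero => simp [List.length_eq_zero_iff]
  | succ d ih =>
    rw [Function.iterate_succ_apply, ih]
    constructor
    · rintro ⟨e₁, he₁, ys, rfl, hys, rfl⟩
      simp only [expansion, List.mem_reverse, List.mem_flatMap, List.mem_map] at he₁
      obtain ⟨e₀, he₀, y, hy, rfl⟩ := he₁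
      exact ⟨e₀, he₀, y :: ys, rfl, by simpa [hy] using hys, rfl⟩
    · rintro ⟨e₀, he₀, ys, hl, hys, rfl⟩
      cases ys with
      | nil => simp at hl
      | cons y ys =>
        refine ⟨exclude a v e₀ y, ?_, ys, by simpa using hl, fun z hz => hys z (by simp [hz]), rfl⟩
        simp only [expansion, List.mem_reverse, List.mem_flatMap, List.mem_map]
        exact ⟨e₀, he₀, y, hys y (by simp), rfl⟩

theorem foldl_exclude (a : V → V → Bool) (v : V) (ys : List V) (e : V → Bool) (u : V) :
    ys.foldl (exclude a v) e u = false ↔ e u = false ∧ ∀ y ∈ ys, a y u = a y v := by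
  induction ys generalizing e with
  | nil => simp
  | cons y ys ih =>
    rw [List.foldl_cons, ih]
    simp [exclude, and_assoc]

end Expansion

/-! ### The kept vertices: enough similar ones, and few in total -/

section Vertices

variable {n : ℕ}

theorem drop_finRange_of_eq_append {pre post : List (Fin n)} {v : Fin n}
    (h : List.finRange n = pre ++ v :: post) : post = (List.finRange n).drop (v + 1) := by
  have hl : pre.length < (List.finRange n).length := by rw [h]; simp
  have hv : (List.finRange n)[pre.length] = v := by simp [h]
  have hp : pre.length = v := by
    rw [List.getElem_finRange] at hv
    simp [← hv]
  rw [← hp, h, List.drop_append]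
  simp

theorem mem_drop_finRange (u v : Fin n) : u ∈ (List.finRange n).drop (v + 1) ↔ v < u := by
  rw [List.mem_drop_iff_getElem]
  constructor
  · rintro ⟨i, hi, rfl⟩
    rw [Fin.lt_def]
    simp
    omega
  · intro h
    rw [Fin.lt_def] at h
    exact ⟨u - (v + 1), by simp; omega, by ext; simp; omega⟩

open Classical in
/-- The vertices after `v` and outside of `X` that are adjacent to the same vertices in `ys` as
`v` is. -/
noncomputable def similarAfter (G : SimpleGraph (Fin n)) (X : Finset (Fin n)) (v : Fin n)
    (ys : List (Fin n)) : Finset (Fin n) :=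
  {u | v < u ∧ u ∉ X ∧ ∀ y ∈ ys, (G.Adj y u ↔ G.Adj y v)}

open Classical in
/-- The vertices that belong to `X`, or to the last `M` vertices of some class of vertices that have
the same neighbours among `k` vertices. -/
noncomputable def keptSet (G : SimpleGraph (Fin n)) (X : Finset (Fin n)) (k M : ℕ) :
    Finset (Fin n) :=
  {v | v ∈ X ∨ ∃ ys : List (Fin n), ys.length = k ∧ (similarAfter G X v ys).card < M}

theorem mem_keptSet {G : SimpleGraph (Fin n)} {X : Finset (Fin n)} {k M : ℕ} {v : Fin n} :
    v ∈ keptSet G X k M ↔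
      v ∈ X ∨ ∃ ys : List (Fin n), ys.length = k ∧ (similarAfter G X v ys).card < M := by
  simp [keptSet]

theorem mem_similarAfter {G : SimpleGraph (Fin n)} {X : Finset (Fin n)} {u v : Fin n}
    {ys : List (Fin n)} : u ∈ similarAfter G X v ys ↔
      v < u ∧ u ∉ X ∧ ∀ y ∈ ys, (G.Adj y u ↔ G.Adj y v) := by
  simp [similarAfter]

open Classical in
theorem isKept_iff (G : SimpleGraph (Fin n)) (X : Finset (Fin n)) (x : Fin n → Bool)
    (hx : ∀ v, x v = true ↔ v ∈ X) (k M : ℕ) (v : Fin n) :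
    isKept (List.finRange n) ((List.finRange n).drop (v + 1)) x (fun y u => decide (G.Adj y u)) k M
      v = true ↔ v ∈ keptSet G X k M := by
  have hcount : ∀ ys : List (Fin n), ((List.finRange n).drop (v + 1)).countP
      (fun u => !(ys.foldl (exclude (fun y u => decide (G.Adj y u)) v) x u)) =
        (similarAfter G X v ys).card := by
    intro ys
    rw [List.countP_eq_length_filter, ← List.toFinset_card_of_nodup
      (((List.nodup_finRange n).drop).filter _)]
    congr 1
    ext u
    rw [List.mem_toFinset, List.mem_filter, mem_drop_finRange, mem_similarAfter, Bool.not_eq_true',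
      foldl_exclude, ← Bool.not_eq_true, hx]
    simp
  rw [isKept, Bool.or_eq_true, hx, mem_keptSet, isSparse, List.any_eq_true]
  refine or_congr Iff.rfl ?_
  constructor
  · rintro ⟨e, he, h⟩
    obtain ⟨e₀, he₀, ys, hl, -, rfl⟩ := (mem_iterate_expansion _ _ _ _ _ _).1 he
    obtain rfl := List.mem_singleton.1 he₀
    exact ⟨ys, hl, by rw [← hcount]; simpa using h⟩
  · rintro ⟨ys, hl, h⟩
    refine ⟨_, (mem_iterate_expansion _ _ _ _ _ _).2
      ⟨x, List.mem_singleton_self _, ys, hl, fun y _ => List.mem_finRange y, rfl⟩, ?_⟩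
    rw [← hcount] at h
    simpa using h

/-- Consider the last deleted vertex w after v and similar to it, or v itself if there is none. As w
is deleted, at least M similar vertices follow it, and all of them are kept because w is last. -/
theorem exists_similar_in_keptSet (G : SimpleGraph (Fin n)) (X : Finset (Fin n)) (k M : ℕ)
    {v : Fin n} (hv : v ∉ keptSet G X k M) (Y : Finset (Fin n)) (hY : Y.card ≤ k) :
    ∃ U : Finset (Fin n), U ⊆ keptSet G X k M ∧ M ≤ U.card ∧
      ∀ u ∈ U, ∀ y ∈ Y, (G.Adj u y ↔ G.Adj v y) := by
  classical
  -- Tuples have length exactly k; padding with v only adds conditions, which does no harm.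
  set ys := Y.toList ++ List.replicate (k - Y.card) v with hys
  have hl : ys.length = k := by simp [hys]; omega
  have hlarge : ∀ w, w ∉ keptSet G X k M → M ≤ (similarAfter G X w ys).card := by
    intro w hw
    by_contra h
    exact hw (mem_keptSet.2 (Or.inr ⟨ys, hl, not_le.1 h⟩))
  refine ⟨(similarAfter G X v ys).filter (· ∈ keptSet G X k M), fun u hu =>
    (Finset.mem_filter.1 hu).2, ?_, fun u hu y hy => ?_⟩
  · by_cases hC : ((similarAfter G X v ys).filter (· ∉ keptSet G X k M)).Nonempty
    · obtain ⟨w, hw, hmax⟩ := Finset.exists_max_image _ id hC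
      obtain ⟨hwC, hwK⟩ := Finset.mem_filter.1 hw
      refine (hlarge w hwK).trans (Finset.card_le_card fun u hu => ?_)
      have hwC' := mem_similarAfter.1 hwC
      have hu' := mem_similarAfter.1 hu
      have huC : u ∈ similarAfter G X v ys := mem_similarAfter.2
        ⟨hwC'.1.trans hu'.1, hu'.2.1, fun y hy => (hu'.2.2 y hy).trans (hwC'.2.2 y hy)⟩
      refine Finset.mem_filter.2 ⟨huC, ?_⟩
      by_contra huK
      exact absurd (hmax u (Finset.mem_filter.2 ⟨huC, huK⟩)) (not_le.2 hu'.1)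
    · refine (hlarge v hv).trans (Finset.card_le_card fun u hu => Finset.mem_filter.2 ⟨hu, ?_⟩)
      by_contra huK
      exact hC ⟨u, Finset.mem_filter.2 ⟨hu, huK⟩⟩
  · have := (mem_similarAfter.1 (Finset.mem_filter.1 hu).1).2.2 y (by simp [hys, hy])
    rwa [G.adj_comm u, G.adj_comm v]

/-- Each kept vertex outside X chooses a witnessing tuple; its signature records the entries in X
and the adjacencies to all entries. Vertices with equal signatures are similar with respect to the
tuple of the first of them, which has fewer than M similar successors, so a signature occurs at most
M times. For k = 0 there are no entries, and X need not be a cover. -/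
theorem card_keptSet_le (G : SimpleGraph (Fin n)) (X : Finset (Fin n)) (k M : ℕ)
    (hX : k = 0 ∨ G.IsVertexCover (X : Set (Fin n))) :
    (keptSet G X k M).card ≤ X.card + M * (2 * (X.card + 1)) ^ k := by
  classical
  have hex : ∀ v ∈ keptSet G X k M \ X, ∃ f : Fin k → Fin n,
      (similarAfter G X v (List.ofFn f)).card < M := by
    intro v hv
    rw [Finset.mem_sdiff, mem_keptSet] at hv
    obtain ⟨ys, rfl, h⟩ := hv.1.resolve_left hv.2
    exact ⟨ys.get, by rwa [List.ofFn_get]⟩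
  choose! f hf using hex
  let φ : Fin n → Fin k → Option (Fin n) × Bool := fun v i =>
    (if f v i ∈ X then some (f v i) else none, decide (G.Adj (f v i) v))
  have hcard : (keptSet G X k M \ X).card ≤ M * (Fintype.piFinset fun _ : Fin k =>
      Finset.insertNone X ×ˢ (Finset.univ : Finset Bool)).card := by
    refine Finset.card_le_mul_card_image_of_maps_to (f := φ) (fun v _ => ?_) M fun b _ => ?_
    · rw [Fintype.mem_piFinset]
      intro i
      rw [Finset.mem_product]
      refine ⟨?_, Finset.mem_univ _⟩
      simp only [φ]
      split_ifs with h
      · simpa using h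
      · simp
    · rcases Finset.eq_empty_or_nonempty {v ∈ keptSet G X k M \ X | φ v = b} with he | hne
      · simp [he]
      · obtain ⟨v, hv, hmin⟩ := Finset.exists_min_image _ id hne
        obtain ⟨hvK, rfl⟩ := Finset.mem_filter.1 hv
        have hsub : ({u ∈ keptSet G X k M \ X | φ u = φ v}).erase v ⊆
            similarAfter G X v (List.ofFn (f v)) := by
          intro u hu
          obtain ⟨huv, hu⟩ := Finset.mem_erase.1 hu
          obtain ⟨huK, huφ⟩ := Finset.mem_filter.1 hu
          have huX := (Finset.mem_sdiff.1 huK).2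
          have hvX := (Finset.mem_sdiff.1 hvK).2
          refine mem_similarAfter.2 ⟨lt_of_le_of_ne (hmin u hu) (Ne.symm huv), huX, fun y hy => ?_⟩
          obtain ⟨i, rfl⟩ := (List.mem_ofFn' _ _).1 hy
          have hi := congrFun huφ i
          simp only [φ, Prod.mk.injEq, decide_eq_decide] at hi
          by_cases hy : f v i ∈ X
          · rw [if_pos hy] at hi
            by_cases hyu : f u i ∈ X
            · rw [if_pos hyu, Option.some_inj] at hi
              rw [← hi.2, hi.1]
            · rw [if_neg hyu] at hi
              exact absurd hi.1 (by simp)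
          · have hcov := hX.resolve_left (by rintro rfl; exact i.elim0)
            exact iff_of_false (fun h => (hcov h).elim hy huX) (fun h => (hcov h).elim hy hvX)
        have h1 := Finset.card_le_card hsub
        have h2 := hf v hvK
        rw [Finset.card_erase_of_mem hv] at h1
        omega
  have hpi : (Fintype.piFinset fun _ : Fin k =>
      Finset.insertNone X ×ˢ (Finset.univ : Finset Bool)).card = (2 * (X.card + 1)) ^ k := by
    simp [mul_comm]
  rw [hpi] at hcard
  have := Finset.card_le_card_sdiff_add_card (s := keptSet G X k M) (t := X)
  omega

end Vertices

end KernelProgram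

/-! ### The kernelization map: equivalence, running time and size -/

namespace KernelProgram

open StackLang

variable {n : ℕ}

theorem flatten_ofFn {α : Type} (f : Fin n → List α) :
    (List.ofFn f).flatten = (List.finRange n).flatMap f := by
  rw [List.ofFn_eq_map, List.flatMap_def]

open Classical in
/-- The part of the vertex cover that is used: all of it or nothing. -/
noncomputable def usedCover (b : Bool) (I : VCInstance) : Finset (Fin I.n) := if b then I.X else ∅

theorem card_usedCover (b : Bool) (I : VCInstance) :
    (usedCover b I).card = if b then I.param else 0 := by
  cases b <;> simp [usedCover, VCInstance.param]

/-- The number of similar vertices that are kept. -/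
noncomputable def limit (b : Bool) (m d : ℕ) (I : VCInstance) : ℕ :=
  m * ((usedCover b I).card + 1) ^ d

/-- The vertices of the kernel. -/
noncomputable def kernelSet (b : Bool) (m d k : ℕ) (I : VCInstance) : Finset (Fin I.n) :=
  keptSet I.G (usedCover b I) k (limit b m d I)

open Classical in
/-- The vertices of the kernel, in order. -/
noncomputable def kernelList (b : Bool) (m d k : ℕ) (I : VCInstance) : List (Fin I.n) :=
  (List.finRange I.n).filter fun v => v ∈ kernelSet b m d k I

theorem mem_kernelList {b : Bool} {m d k : ℕ} {I : VCInstance} {v : Fin I.n} :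
    v ∈ kernelList b m d k I ↔ v ∈ kernelSet b m d k I := by
  simp [kernelList]

theorem nodup_kernelList (b : Bool) (m d k : ℕ) (I : VCInstance) :
    (kernelList b m d k I).Nodup := (List.nodup_finRange _).filter _

open Classical in
/-- The kernel: the subgraph induced by the kept vertices. -/
noncomputable def kernel (b : Bool) (m d k : ℕ) (I : VCInstance) : VCInstance where
  n := (kernelList b m d k I).length
  G := I.G.comap (kernelList b m d k I).get
  X := Finset.univ.filter fun i => (kernelList b m d k I).get i ∈ I.X
  isVertexCover := fun i j hij => by simpa using I.isVertexCover hij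

theorem mem_kernel_X (b : Bool) (m d k : ℕ) (I : VCInstance)
    (i : Fin (kernelList b m d k I).length) :
    i ∈ (kernel b m d k I).X ↔ (kernelList b m d k I).get i ∈ I.X := by
  unfold kernel
  exact Finset.mem_filter.trans (and_iff_right (Finset.mem_univ _))

theorem kernel_n (b : Bool) (m d k : ℕ) (I : VCInstance) :
    (kernel b m d k I).n = (kernelSet b m d k I).card := by
  classical
  change (kernelList b m d k I).length = _
  rw [← List.toFinset_card_of_nodup (nodup_kernelList b m d k I)]
  congr 1
  ext v
  rw [List.mem_toFinset, mem_kernelList]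

open Classical in
theorem encode_eq (I : VCInstance) : I.encode = (List.finRange I.n).flatMap
    (row (List.finRange I.n) (fun v => decide (v ∈ I.X)) fun v w => decide (I.G.Adj v w)) := by
  rw [VCInstance.encode, flatten_ofFn]
  congr 1
  funext v
  rw [VCInstance.encodeRow, List.ofFn_eq_map]
  rfl

open Classical in
-- Brings the encoding of the kernel, whose vertices are renumbered, into the form that the program
-- writes: original rows with deleted rows and columns left out.
theorem encode_kernel (b : Bool) (m d k : ℕ) (I : VCInstance) : (kernel b m d k I).encode =
    (kernelList b m d k I).flatMap (row (kernelList b m d k I) (fun v => decide (v ∈ I.X))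
      fun v w => decide (I.G.Adj v w)) := by
  have h : ∀ {α : Type} (f : Fin I.n → α), (List.finRange (kernelList b m d k I).length).map
      (fun i => f ((kernelList b m d k I).get i)) = (kernelList b m d k I).map f := by
    intro α f
    conv_rhs => rw [← List.ofFn_get (kernelList b m d k I), List.ofFn_eq_map, List.map_map]
    rfl
  rw [encode_eq, List.flatMap_def, List.flatMap_def, ← h]
  congr 1
  refine List.map_congr_left fun i _ => ?_
  have hX : decide (i ∈ (kernel b m d k I).X) =
      decide ((kernelList b m d k I).get i ∈ I.X) := by
    rw [decide_eq_decide]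
    exact mem_kernel_X b m d k I i
  have hG : ∀ j, decide ((kernel b m d k I).G.Adj i j) =
      decide (I.G.Adj ((kernelList b m d k I).get i) ((kernelList b m d k I).get j)) :=
    fun j => rfl
  simp only [row, bits, hX, hG, ← h]
  rfl

theorem hasFreePartition_kernel_iff (P : GraphProperty) {q : ℕ} (hq : 1 ≤ q) (b : Bool)
    (m d k : ℕ) (I : VCInstance) : P.HasFreePartition q (kernel b m d k I).G ↔
      P.FreeOn q I.G (kernelSet b m d k I : Set (Fin I.n)) := by
  have h := P.hasFreePartition_comap_iff hq I.G
    ⟨(kernelList b m d k I).get, (nodup_kernelList b m d k I).injective_get⟩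
  have hr : Set.range (kernelList b m d k I).get = kernelSet b m d k I := by
    ext v
    rw [Finset.mem_coe, ← mem_kernelList, List.mem_iff_get]
    rfl
  rw [← hr]
  exact h

theorem equivalent_kernel (P : GraphProperty) {q c : ℕ} (hq : 1 ≤ q)
    (hP : P.CharacterizedByAdjacencies c) {b : Bool} {m d k r : ℕ} {I : VCInstance}
    (hmin : ∀ T : Set (Fin I.n), P.IsVertexMinimal (I.G.induce T) → Nat.card T ≤ r)
    (hr : r = 0 ∨ (q * c ≤ k ∧ q * r ≤ limit b m d I)) :
    I ∈ PartitionIntoFree P q ↔ kernel b m d k I ∈ PartitionIntoFree P q := by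
  change P.HasFreePartition q I.G ↔ P.HasFreePartition q (kernel b m d k I).G
  rw [hasFreePartition_kernel_iff P hq, P.hasFreePartition_iff hq]
  refine ⟨GraphProperty.FreeOn.mono (Set.subset_univ _), GraphProperty.FreeOn.extend hq hP hmin ?_⟩
  intro v hv Y hY
  obtain rfl | ⟨hk, hr⟩ := hr
  -- If minimal members have no vertices, q·r = 0 similar vertices are enough.
  · exact ⟨∅, by simp, by simp, by simp⟩
  · obtain ⟨U, hU, h1, h2⟩ := exists_similar_in_keptSet I.G (usedCover b I) k (limit b m d I)
      (v := v) hv Y (hY.trans hk)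
    exact ⟨U, by exact_mod_cast hU, hr.trans h1, h2⟩

/-- A polynomial that bounds the running time. -/
noncomputable def timePolynomial (m d k : ℕ) : Polynomial ℕ :=
  let X : Polynomial ℕ := Polynomial.X
  let M : Polynomial ℕ := .C m * (X + 1) ^ d
  .C d * (6 * .C m * (X + 1) ^ d + 2) +
    X * (.C k * (10 * (X + 1) ^ (k + 1) + 3) + (X + 1) ^ k * (2 * X + 2 * M + 4) + 4 * X + 6 + 2) +
    2 * M + 10 * (X + 1) ^ 2 + 20 * X + 20

theorem eval_timePolynomial (m d k n : ℕ) :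
    (timePolynomial m d k).eval n = programTime m d k n := by
  simp [timePolynomial, programTime, vertexTime]

theorem programTime_mono (m d k : ℕ) : Monotone (programTime m d k) := by
  intro i j hij
  unfold programTime vertexTime
  gcongr

theorem polyTime_kernel (b : Bool) (m d k : ℕ) : Nonempty
    (Turing.TM2ComputableInPolyTime VCInstance.encode VCInstance.encode (kernel b m d k)) := by
  classical
  refine Prog.nonempty_computable _ _ _ (program b m d k) .inp .out (timePolynomial m d k)
    fun I => ?_
  set x : Fin I.n → Bool := fun v => decide (v ∈ I.X) with hx
  have hxb : ∀ v, (x v && b) = true ↔ v ∈ usedCover b I := by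
    intro v; cases b <;> simp [usedCover, hx]
  have hcount : (List.finRange I.n).countP (fun u => x u && b) = (usedCover b I).card := by
    rw [List.countP_eq_length_filter, ← List.toFinset_card_of_nodup
      ((List.nodup_finRange _).filter _)]
    congr 1
    ext u
    rw [List.mem_toFinset, List.mem_filter, hxb]
    simp
  have h := exec_program b m d k (List.finRange I.n) x
    (fun v => decide (v ∈ kernelSet b m d k I)) (fun v w => decide (I.G.Adj v w))
    (by
      intro pre v post hvs
      rw [drop_finRange_of_eq_append hvs, hcount, Bool.eq_iff_iff, decide_eq_true_iff,
        isKept_iff I.G (usedCover b I) _ hxb]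
      rfl)
  have h1 : (Function.update (fun _ => []) Stk.inp I.encode : Store Stk Sym) =
      State.store { inp := I.encode } := by
    funext k; cases k <;> rfl
  have h2 : (Function.update (fun _ => []) Stk.out (kernel b m d k I).encode : Store Stk Sym) =
      State.store { out := (kernel b m d k I).encode } := by
    funext k; cases k <;> rfl
  rw [h1, h2, encode_kernel]
  rw [← encode_eq] at h
  refine h.mono ?_
  rw [eval_timePolynomial, VCInstance.length_encode, List.length_finRange]
  exact programTime_mono m d k (by nlinarith)

/-- A bound on the number of vertices of the kernel. -/
def sizeBound (b : Bool) (m d k x : ℕ) : ℕ :=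
  (if b then x else 0) + m * ((if b then x else 0) + 1) ^ d * (2 * ((if b then x else 0) + 1)) ^ k

theorem kernel_n_le {b : Bool} {k : ℕ} (hbk : b = true ∨ k = 0) (m d : ℕ) (I : VCInstance) :
    (kernel b m d k I).n ≤ sizeBound b m d k I.param := by
  rw [kernel_n]
  have := card_keptSet_le I.G (usedCover b I) k (limit b m d I) (by
    rcases hbk with rfl | rfl
    · exact Or.inr (by simpa [usedCover] using I.isVertexCover)
    · exact Or.inl rfl)
  rw [limit, card_usedCover] at this
  rw [kernelSet, limit, card_usedCover]
  exact this

theorem primrec_pow_const {f : ℕ → ℕ} (hf : Primrec f) (e : ℕ) : Primrec fun x => f x ^ e := by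
  induction e with
  | zero => simpa using Primrec.const 1
  | succ e ih => simpa [pow_succ] using Primrec.nat_mul.comp ih hf

theorem primrec_sizeBound (b : Bool) (m d k : ℕ) : Primrec (sizeBound b m d k) := by
  have he : Primrec fun x : ℕ => if b then x else 0 := by
    cases b
    · simpa using Primrec.const 0
    · exact Primrec.id
  have h1 := Primrec.nat_add.comp he (Primrec.const 1)
  exact Primrec.nat_add.comp he (Primrec.nat_mul.comp
    (Primrec.nat_mul.comp (Primrec.const m) (primrec_pow_const h1 d))
    (primrec_pow_const (Primrec.nat_mul.comp (Primrec.const 2) h1) k))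

theorem isKernelization_kernel {Q : Set VCInstance} {b : Bool} {m d k : ℕ}
    (hbk : b = true ∨ k = 0) (hQ : ∀ I, I ∈ Q ↔ kernel b m d k I ∈ Q) :
    IsKernelization Q (kernel b m d k) where
  polyTime := polyTime_kernel b m d k
  equivalent := hQ
  size := by
    -- The size function is built from the explicit `sizeBound`, so its computability is immediate.
    have hg := primrec_sizeBound b m d k
    refine ⟨fun x => sizeBound b m d k x * (sizeBound b m d k x + 2),
      (Primrec.nat_mul.comp hg (Primrec.nat_add.comp hg (Primrec.const 2))).to_comp, fun I => ?_⟩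
    have h := kernel_n_le hbk m d I
    constructor
    · rw [VCInstance.length_encode]
      exact Nat.mul_le_mul h (Nat.add_le_add_right h 2)
    · have hX : (kernel b m d k I).param ≤ (kernel b m d k I).n :=
        (Finset.card_le_univ _).trans_eq (Fintype.card_fin _)
      exact (hX.trans h).trans (Nat.le_mul_of_pos_right _ (by omega))

theorem hasKernel {Q : Set VCInstance} {b : Bool} {m d k : ℕ} {B : ℕ → ℝ}
    (hbk : b = true ∨ k = 0) (hQ : ∀ I, I ∈ Q ↔ kernel b m d k I ∈ Q)
    (hB : (fun x => (sizeBound b m d k x : ℝ)) =O[atTop] B) : HasKernelWithVertexBound Q B :=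
  ⟨_, isKernelization_kernel hbk hQ, _, hB, kernel_n_le hbk m d⟩

end KernelProgram

/-! ### Polynomial bounds -/

/-- d is the degree and m the rounded-up sum of the absolute values of the coefficients. Since p is
not identically zero, the leading coefficient is nonzero and x^d is bounded by a multiple of p(x)
for large x. -/
theorem IsNondecreasingPolynomial.exists_bounds {p : ℕ → ℕ} (hp : IsNondecreasingPolynomial p)
    (h0 : ∃ x, p x ≠ 0) : ∃ d m : ℕ, (∀ x, p x ≤ m * (x + 1) ^ d) ∧
      (fun x : ℕ => (x : ℝ) ^ d) =O[atTop] fun x => (p x : ℝ) := by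
  obtain ⟨-, F, hF⟩ := hp
  have hF0 : F ≠ 0 := by
    rintro rfl
    obtain ⟨x, hx⟩ := h0
    have := hF x
    simp at this
    exact hx this
  refine ⟨F.natDegree, ⌈∑ i ∈ Finset.range (F.natDegree + 1), |F.coeff i|⌉₊, fun x => ?_, ?_⟩
  · have h : (p x : ℝ) ≤ (⌈∑ i ∈ Finset.range (F.natDegree + 1), |F.coeff i|⌉₊ : ℝ) *
        ((x : ℝ) + 1) ^ F.natDegree := by
      rw [hF, Polynomial.eval_eq_sum_range]
      calc _ ≤ ∑ i ∈ Finset.range (F.natDegree + 1), |F.coeff i| * ((x : ℝ) + 1) ^ F.natDegree := by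
            refine Finset.sum_le_sum fun i hi => ?_
            have hx : (x : ℝ) ^ i ≤ ((x : ℝ) + 1) ^ F.natDegree :=
              (pow_le_pow_left₀ (by positivity) (by linarith) i).trans
                (pow_le_pow_right₀ (by linarith [(Nat.cast_nonneg x : (0 : ℝ) ≤ x)])
                  (by simpa [Nat.lt_succ_iff] using hi))
            exact mul_le_mul (le_abs_self _) hx (by positivity) (abs_nonneg _)
        _ = (∑ i ∈ Finset.range (F.natDegree + 1), |F.coeff i|) * ((x : ℝ) + 1) ^ F.natDegree := by
            rw [Finset.sum_mul]
        _ ≤ _ := by gcongr; exact Nat.le_ceil _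
    exact_mod_cast h
  · have h1 := F.isEquivalent_atTop_lead.symm.isBigO.comp_tendsto tendsto_natCast_atTop_atTop
    have h2 : (fun x : ℝ => x ^ F.natDegree) =O[atTop]
        fun x => F.leadingCoeff * x ^ F.natDegree :=
      isBigO_self_const_mul (Polynomial.leadingCoeff_ne_zero.2 hF0) _ _
    refine ((h2.comp_tendsto tendsto_natCast_atTop_atTop).trans h1).congr (fun x => rfl) fun x => ?_
    exact (hF x).symm

/-- For k ≥ 1 the cover itself is absorbed by x ≤ x^d·x^k; for x ≥ 1 the bound x + 1 ≤ 2x gives the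
constants 2^d and 4^k. -/
theorem KernelProgram.isBigO_sizeBound {p : ℕ → ℕ} {d k : ℕ} (hk : k ≠ 0) (m : ℕ)
    (hd : (fun x : ℕ => (x : ℝ) ^ d) =O[atTop] fun x => (p x : ℝ)) :
    (fun x => (sizeBound true m d k x : ℝ)) =O[atTop] fun x => (p x : ℝ) * (x : ℝ) ^ k := by
  refine IsBigO.trans ?_ (hd.mul (isBigO_refl (fun x : ℕ => (x : ℝ) ^ k) atTop))
  refine IsBigO.of_bound (1 + m * 2 ^ d * 4 ^ k) ?_
  filter_upwards [eventually_ge_atTop 1] with x hx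
  rw [Real.norm_of_nonneg (by positivity), Real.norm_of_nonneg (by positivity)]
  have h1 : x ≤ x ^ d * x ^ k := by
    rw [← pow_add]
    exact Nat.le_self_pow (by omega) x
  have h2 : sizeBound true m d k x ≤ (1 + m * 2 ^ d * 4 ^ k) * (x ^ d * x ^ k) := by
    calc sizeBound true m d k x = x + m * (x + 1) ^ d * (2 * (x + 1)) ^ k := by simp [sizeBound]
      _ ≤ x ^ d * x ^ k + m * (2 * x) ^ d * (4 * x) ^ k :=
          Nat.add_le_add h1 (Nat.mul_le_mul (Nat.mul_le_mul_left m
            (Nat.pow_le_pow_left (by omega) d)) (Nat.pow_le_pow_left (by omega) k))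
      _ = _ := by rw [mul_pow, mul_pow]; ring
  exact_mod_cast h2

/-! ### The kernelization theorem -/

theorem theorem3p3 (P : GraphProperty) (q c : ℕ) (hq : 1 ≤ q)
    (hP : P.CharacterizedByAdjacencies c)
    (p : ℕ → ℕ) (hp : IsNondecreasingPolynomial p)
    (hmin : ∀ (V : Type) [Finite V] (G : SimpleGraph V), P.IsVertexMinimal G →
      Nat.card V ≤ p G.vertexCoverNum.toNat) :
    HasKernelWithVertexBound (PartitionIntoFree P q)
      (fun x => (p x : ℝ) * (x : ℝ) ^ (q * c)) := by
  by_cases h0 : ∃ x, p x ≠ 0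
  · obtain ⟨d, m, hm, hd⟩ := hp.exists_bounds h0
    rcases Nat.eq_zero_or_pos c with rfl | hc
    -- The cover is ignored and tuples are empty, so only the last q·p(0) vertices stay; p(x) ≥ 1
    -- for large x makes this constant O(p(x)).
    · refine KernelProgram.hasKernel (b := false) (m := q * p 0) (d := 0) (k := 0) (Or.inr rfl)
        (fun I => KernelProgram.equivalent_kernel P hq hP (r := p 0)
          (fun T hT => hP.card_le hmin _ hT) (Or.inr ⟨by simp, by simp [KernelProgram.limit]⟩)) ?_
      obtain ⟨x₀, hx₀⟩ := h0
      refine IsBigO.of_bound (q * p 0) ?_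
      filter_upwards [eventually_ge_atTop x₀] with x hx
      have h1 : (1 : ℝ) ≤ p x := by
        exact_mod_cast (Nat.one_le_iff_ne_zero.2 hx₀).trans (hp.1 hx)
      have h2 : (0 : ℝ) ≤ q * p 0 := by positivity
      simpa [KernelProgram.sizeBound] using le_mul_of_one_le_right h2 h1
    -- The limit q·m·(x+1)^d is at least q·p(x), with x the size of the given cover, which bounds
    -- the vertex cover number of each induced subgraph.
    · refine KernelProgram.hasKernel (b := true) (m := q * m) (d := d) (k := q * c) (Or.inl rfl)
        (fun I => KernelProgram.equivalent_kernel P hq hP (r := p I.param)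
          (fun T hT => GraphProperty.card_le_of_isVertexCover hp.1 hmin I.isVertexCover T hT)
          (Or.inr ⟨le_rfl, ?_⟩)) (KernelProgram.isBigO_sizeBound (by positivity) _ hd)
      rw [KernelProgram.limit, KernelProgram.card_usedCover, if_pos rfl, mul_assoc]
      exact Nat.mul_le_mul_left q (hm _)
  -- Here the bound is O(0): minimal members have no vertices, and with limit 0 and the cover
  -- ignored the kernel is the empty graph.
  · push Not at h0
    refine KernelProgram.hasKernel (b := false) (m := 0) (d := 0) (k := 0) (Or.inr rfl)
      (fun I => KernelProgram.equivalent_kernel P hq hP (r := 0)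
        (fun T hT => (hmin _ _ hT).trans_eq (h0 _)) (Or.inl rfl)) ?_
    simpa [KernelProgram.sizeBound] using isBigO_zero _ _
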